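/- Let $n\ge 1$. Let $\Theta=(\xi_1,\dots,\xi_N)$ be a collection of $N$ frequencies in $\mathbb R^n$, and let $T$ be a bounded linear operator on $L^2(\mathbb R^n)$ with $\|T\|_{L^2\to L^2}\le B$. Suppose that $T$ is a multi-frequency Calderón–Zygmund operator relatively to $\Theta$ with constant $A$, that is, $T=\sum_{j=1}^N T_j$ for some linear operators $T_j$ from $L^2(\mathbb R^n)$ to measurable functions, and there are kernels $K_1,\dots,K_N$ such that (i) for every $j$ and every compactly supported $f\in L^2(\mathbb R^n)$, $T_j f(x)=\int K_j(x,y)f(y)\,dy$ for almost every $x\notin\operatorname{supp} f$; (ii) the functions $(x,y)\mapsto e^{i\xi_j\cdot(x-y)}K_j(x,y)$ are differentiable at all points with $x\ne y$, and there $$\sum_{j=1}^N\left|\nabla_{(x,y)}\left(e^{i\xi_j\cdot(x-y)}K_j(x,y)\right)\right|\le A\,|x-y|^{-n-1}.$$ Then: (a) for every $p\in(1,\infty)$, the restriction of $T$ to $L^2\cap L^p$ extends to a bounded linear operator on $L^p(\mathbb R^n)$ with $$\|T\|_{L^p\to L^p}\le C_1\,N^{\left|\frac1p-\frac12\right|},$$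 where $C_1$ depends only on $n$, $p$, $A$ and $B$; (b) the restriction of $T$ to $L^1\cap L^2$ extends to a linear operator on $L^1(\mathbb R^n)$ of weak type $(1,1)$ with norm $\lesssim N^{1/2}$: for all $f\in L^1(\mathbb R^n)$ and $t>0$, $$\left|\{x\in\mathbb R^n:\ |Tf(x)|>t\}\right|\le C_2\,N^{\frac12}\,\frac{\|f\|_{L^1}}{t},$$ where $C_2$ depends only on $n$, $A$ and $B$. -/

import Mathlib

open MeasureTheory

/-- The Euclidean space `ℝⁿ`, with its Euclidean norm and Lebesgue measure `volume`. -/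
abbrev Rn (n : ℕ) : Type := EuclideanSpace ℝ (Fin n)

/-- The space `Lᵖ(ℝⁿ, ℂ)`. -/
abbrev LpRn (n : ℕ) (p : ENNReal) : Type := Lp (α := Rn n) ℂ p volume

/-- The modulated kernel `(x, y) ↦ exp (i ξ · (x - y)) K(x, y)`. -/
noncomputable def modulatedKernel {n : ℕ} (ξ : Rn n) (K : Rn n → Rn n → ℂ) : Rn n × Rn n → ℂ :=
  fun z => Complex.exp (Complex.I * ((inner ℝ ξ (z.1 - z.2) : ℝ) : ℂ)) * K z.1 z.2

/-- `S` has the kernel `K` off the diagonal: for every compactly supported `f ∈ L²` and almost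
every `x` outside the support of `f`, `S f (x) = ∫ K(x, y) f(y) dy`.
The values of `S` are measurable functions up to equality almost everywhere. -/
def HasOffDiagonalKernel {n : ℕ} (S : LpRn n 2 →ₗ[ℂ] (Rn n →ₘ[volume] ℂ))
    (K : Rn n → Rn n → ℂ) : Prop :=
  ∀ (f : Rn n → ℂ) (hf : MemLp f 2 volume), HasCompactSupport f →
    ∀ᵐ x ∂(volume : Measure (Rn n)), x ∉ tsupport f →
      S (hf.toLp f) x = ∫ y, K x y * f y

/-- The modulated kernels are differentiable off the diagonal, and jointly satisfy there
`∑ j, |∇_{(x,y)} (exp (i ξ_j · (x - y)) K_j(x, y))| ≤ A |x - y| ^ (-n-1)`. The length of the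
gradient is measured as the operator norm of the derivative on `ℝⁿ × ℝⁿ`. -/
def JointGradientBound {n N : ℕ} (ξ : Fin N → Rn n) (K : Fin N → Rn n → Rn n → ℂ) (A : ℝ) :
    Prop :=
  ∀ x y : Rn n, x ≠ y →
    (∀ j, DifferentiableAt ℝ (modulatedKernel (ξ j) (K j)) (x, y)) ∧
    ∑ j, ‖fderiv ℝ (modulatedKernel (ξ j) (K j)) (x, y)‖ ≤ A / ‖x - y‖ ^ (n + 1)

/-- The bounded operator `T` on `L²(ℝⁿ)` is a multi-frequency Calderón–Zygmund operator relatively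
to the frequencies `ξ 0, …, ξ (N - 1)`, with constant `A` in the regularity of the kernels.
The pieces `S j` are linear, but only their sum is supposed to be bounded on `L²`. -/
def IsMultiFrequencyCZ {n N : ℕ} (ξ : Fin N → Rn n) (A : ℝ) (T : LpRn n 2 →L[ℂ] LpRn n 2) :
    Prop :=
  ∃ (S : Fin N → LpRn n 2 →ₗ[ℂ] (Rn n →ₘ[volume] ℂ)) (K : Fin N → Rn n → Rn n → ℂ),
    (∀ f : LpRn n 2, (T f : Rn n →ₘ[volume] ℂ) = ∑ j, S j f) ∧
    (∀ j, HasOffDiagonalKernel (S j) (K j)) ∧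
    JointGradientBound ξ K A

/-- `T` is bounded on `Lᵖ` with norm at most `C`: there is a linear operator on all of `Lᵖ` that
agrees with `T` on `L² ∩ Lᵖ` and whose norm is at most `C`. -/
def IsBoundedOnLp {n : ℕ} (T : LpRn n 2 →L[ℂ] LpRn n 2) (p : ENNReal) (C : ℝ) : Prop :=
  ∃ U : LpRn n p →ₗ[ℂ] LpRn n p,
    (∀ (f : LpRn n 2) (g : LpRn n p), f =ᵐ[volume] g → T f =ᵐ[volume] U g) ∧
    ∀ g : LpRn n p, ‖U g‖ ≤ C * ‖g‖

/-- `T` is of weak type `(1, 1)` with norm at most `C`: there is a linear operator from all of `L¹`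
to measurable functions that agrees with `T` on `L¹ ∩ L²` and satisfies
`t |{x : |U g (x)| > t}| ≤ C ‖g‖₁` for all `t > 0`. -/
def IsWeakTypeOneOne {n : ℕ} (T : LpRn n 2 →L[ℂ] LpRn n 2) (C : ℝ) : Prop :=
  ∃ U : LpRn n 1 →ₗ[ℂ] (Rn n →ₘ[volume] ℂ),
    (∀ (f : LpRn n 2) (g : LpRn n 1), f =ᵐ[volume] g → T f =ᵐ[volume] U g) ∧
    ∀ (g : LpRn n 1) (t : ℝ), 0 < t →
      volume {x : Rn n | t < ‖U g x‖} ≤ ENNReal.ofReal (C * ‖g‖ / t)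

/-! The core is a weak type estimate on L¹ ∩ L², proved by a Calderón–Zygmund decomposition adapted
to N frequencies. At height t the function f is cut at the lower level t/√N, and the exceptional set
Ω then has measure O(√N ‖f‖₁ / t). On a Whitney ball Q of Ω, the piece h of f is replaced not by its
mean but by its orthogonal projection φ, over the tripled ball, onto the span of the N characters.
So b = h - φ has vanishing moments against all of them (`exists_same_moments`).

The cost of the projection is the passage from L¹ to L². An exponential sum P with N frequencies
satisfies |P|² ≤ (N/|Q|) ∫_{3Q} |P|² on Q (`norm_expSum_sq_le`), hence ‖φ‖₂² |Q| ≤ N ‖h‖₁² ≲ N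
(t/√N)² |Q|² = t² |Q|². The level t/√N pays exactly for the factor N: the good part has ‖G‖₂² ≲ t √N
‖f‖₁, and the L² bound of T and Chebyshev suffice for it.

For the bad part, K_j(x, y) is exp(-iξ_j·(x-y)) times a differentiable factor. The moments of b
allow the value of this factor at the centre of Q to be subtracted, for every j at once, and the
gradient bound on the sum over j gives the decay r |x-c|^(-n-1) without loss in N
(`norm_integral_kernelSum_le`). Hence Tb is integrable outside the doubled ball, which lies in Ω,
with norm O(‖b‖₁).

For 1 < p < 2, Marcinkiewicz interpolation with L² (`isStrongType_of_weakType`), splitting f at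
height √N t, balances the two endpoint constants and gives N^(1/p - 1/2). The adjoint satisfies the
same hypotheses with the same frequencies, so p > 2 follows by duality (`IsStrongType.of_adjoint`).
The extensions to Lᵖ and L¹ come from density, in the weak case through almost everywhere limits. -/

open Metric Set Filter
open scoped ENNReal ComplexConjugate

/-! ### Inner products and norms in L² as integrals. -/

section L2

variable {α : Type*} [MeasurableSpace α] {μ : Measure α}

lemma inner_toLp_eq_integral {f g : α → ℂ} (hf : MemLp f 2 μ) (hg : MemLp g 2 μ) :
    inner ℂ (hf.toLp f) (hg.toLp g) = ∫ x, conj (f x) * g x ∂μ := by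
  rw [L2.inner_def]
  refine integral_congr_ae ?_
  filter_upwards [hf.coeFn_toLp, hg.coeFn_toLp] with x h1 h2
  rw [h1, h2, RCLike.inner_apply, mul_comm]

lemma norm_toLp_sq_eq_integral {f : α → ℂ} (hf : MemLp f 2 μ) :
    ‖hf.toLp f‖ ^ 2 = ∫ x, ‖f x‖ ^ 2 ∂μ := by
  have h := inner_toLp_eq_integral hf hf
  rw [inner_self_eq_norm_sq_to_K] at h
  have h2 : (∫ x, conj (f x) * f x ∂μ) = ((∫ x, ‖f x‖ ^ 2 ∂μ : ℝ) : ℂ) := by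
    rw [← integral_complex_ofReal]
    congr 1 with x
    rw [mul_comm, Complex.mul_conj, Complex.normSq_eq_norm_sq]
  rw [h2] at h
  refine Complex.ofReal_injective ?_
  rw [← h, Complex.ofReal_pow]
  rfl

end L2

/-! ### Exponential sums and projection onto the span of N characters. -/

section Exponentials

variable {n N : ℕ}

/-- The character `x ↦ exp (-i ξ · x)`. -/
noncomputable def expChar (ξ x : Rn n) : ℂ :=
  Complex.exp (-(Complex.I * ((inner ℝ ξ x : ℝ) : ℂ)))

lemma continuous_expChar (ξ : Rn n) : Continuous (expChar ξ) := by
  unfold expChar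
  fun_prop

lemma expChar_add (ξ x y : Rn n) : expChar ξ (x + y) = expChar ξ x * expChar ξ y := by
  simp only [expChar, ← Complex.exp_add, inner_add_right]
  push_cast
  ring_nf

@[simp] lemma norm_expChar (ξ x : Rn n) : ‖expChar ξ x‖ = 1 := by
  simp [expChar, Complex.norm_exp]

lemma conj_expChar (ξ x : Rn n) :
    conj (expChar ξ x) = Complex.exp (Complex.I * ((inner ℝ ξ x : ℝ) : ℂ)) := by
  rw [expChar, ← Complex.exp_conj]
  simp

/-- An exponential sum with the given frequencies. -/
noncomputable def expSum (ξ : Fin N → Rn n) (a : Fin N → ℂ) (x : Rn n) : ℂ :=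
  ∑ j, a j * expChar (ξ j) x

lemma continuous_expSum (ξ : Fin N → Rn n) (a : Fin N → ℂ) : Continuous (expSum ξ a) :=
  continuous_finsetSum _ fun j _ => continuous_const.mul (continuous_expChar (ξ j))

lemma memLp_of_continuous_of_bound {f : Rn n → ℂ} (hf : Continuous f) {M : ℝ}
    (hM : ∀ x, ‖f x‖ ≤ M) {p : ℝ≥0∞} {μ : Measure (Rn n)} [IsFiniteMeasure μ] : MemLp f p μ :=
  MemLp.of_bound hf.aestronglyMeasurable M (ae_of_all _ hM)

lemma norm_expSum_le (ξ : Fin N → Rn n) (a : Fin N → ℂ) (x : Rn n) :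
    ‖expSum ξ a x‖ ≤ ∑ j, ‖a j‖ := by
  refine (norm_sum_le _ _).trans (Finset.sum_le_sum fun j _ => ?_)
  simp

lemma memLp_expSum (ξ : Fin N → Rn n) (a : Fin N → ℂ) {p : ℝ≥0∞} {μ : Measure (Rn n)}
    [IsFiniteMeasure μ] : MemLp (expSum ξ a) p μ :=
  memLp_of_continuous_of_bound (continuous_expSum ξ a) (norm_expSum_le ξ a)

lemma memLp_expChar (ξ : Rn n) {p : ℝ≥0∞} {μ : Measure (Rn n)}
    [IsFiniteMeasure μ] : MemLp (expChar ξ) p μ :=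
  memLp_of_continuous_of_bound (continuous_expChar ξ) (M := 1) (by simp)

instance isFiniteMeasure_restrict_ball (x : Rn n) (r : ℝ) :
    IsFiniteMeasure (volume.restrict (ball x r)) :=
  isFiniteMeasure_restrict.2 measure_ball_lt_top.ne

lemma sum_smul_toLp_expChar (ξ : Fin N → Rn n) (a : Fin N → ℂ) {μ : Measure (Rn n)}
    [IsFiniteMeasure μ] :
    ∑ j, a j • (memLp_expChar (ξ j)).toLp (p := 2) (μ := μ) (expChar (ξ j)) =
      (memLp_expSum ξ a).toLp (expSum ξ a) := by
  have h : (memLp_expSum ξ a).toLp (p := 2) (μ := μ) (expSum ξ a) =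
      (memLp_finsetSum' Finset.univ
        fun j _ => (memLp_expChar (ξ j)).const_smul (a j)).toLp (p := 2) (μ := μ)
          (∑ j, a j • expChar (ξ j)) := by
    congr 1
    ext x
    simp [expSum]
  rw [h]
  ext1
  refine (Lp.coeFn_finsetSum _ _).trans ?_
  refine EventuallyEq.trans ?_ (MemLp.coeFn_toLp _).symm
  refine eventuallyEq_sum fun j _ => ?_
  refine (Lp.coeFn_smul _ _).trans ?_
  exact (MemLp.coeFn_toLp _).const_smul (a j)

/-- The span of the characters is translation invariant. This lets a single basis, orthonormal on a
centred ball, serve all translated balls. -/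
lemma expSum_translate (ξ : Fin N → Rn n) (a : Fin N → ℂ) (w z : Rn n) :
    expSum ξ (fun j => a j * expChar (ξ j) w) z = expSum ξ a (z + w) := by
  unfold expSum
  refine Finset.sum_congr rfl fun j _ => ?_
  rw [expChar_add]
  ring

/-- A basis of the exponential sums that is orthonormal on a ball. -/
lemma exists_orthonormal_expSum (ξ : Fin N → Rn n) (r : ℝ) :
    ∃ (m : ℕ) (β : Fin m → Fin N → ℂ), m ≤ N ∧
      (∀ k, ∫ y in ball (0 : Rn n) r, ‖expSum ξ (β k) y‖ ^ 2 = 1) ∧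
      ∀ a : Fin N → ℂ, ∃ c : Fin m → ℂ,
        (∀ y ∈ ball (0 : Rn n) r, expSum ξ a y = ∑ k, c k * expSum ξ (β k) y) ∧
        ∑ k, ‖c k‖ ^ 2 = ∫ y in ball (0 : Rn n) r, ‖expSum ξ a y‖ ^ 2 := by
  set μ := (volume : Measure (Rn n)).restrict (ball 0 r) with hμ
  let e : Fin N → Lp ℂ 2 μ := fun j => (memLp_expChar (ξ j)).toLp (expChar (ξ j))
  let W := Submodule.span ℂ (Set.range e)
  have : FiniteDimensional ℂ W := FiniteDimensional.span_of_finite ℂ (Set.finite_range e)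
  let b := stdOrthonormalBasis ℂ W
  have hb : ∀ k, ∃ β : Fin N → ℂ, ∑ j, β j • e j = (b k : Lp ℂ 2 μ) := fun k =>
    (Submodule.mem_span_range_iff_exists_fun ℂ).1 (b k).2
  choose β hβ using hb
  have hβ' : ∀ k, (memLp_expSum ξ (β k)).toLp (expSum ξ (β k)) = (b k : Lp ℂ 2 μ) := fun k => by
    rw [← hβ k, ← sum_smul_toLp_expChar]
  refine ⟨Module.finrank ℂ W, β, ?_, fun k => ?_, fun a => ?_⟩
  · exact (finrank_range_le_card (R := ℂ) e).trans (by simp)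
  · rw [← norm_toLp_sq_eq_integral (memLp_expSum ξ (β k)), hβ' k]
    have := b.orthonormal.1 k
    rw [Submodule.norm_coe, this, one_pow]
  · have hu : (memLp_expSum ξ a).toLp (expSum ξ a) ∈ W :=
      (Submodule.mem_span_range_iff_exists_fun ℂ).2 ⟨a, sum_smul_toLp_expChar ξ a⟩
    let u : W := ⟨_, hu⟩
    refine ⟨fun k => b.repr u k, ?_, ?_⟩
    · have h1 : ∑ k, (b.repr u k) • (b k : Lp ℂ 2 μ) = (memLp_expSum ξ a).toLp (expSum ξ a) := by
        have := congrArg (Subtype.val : W → Lp ℂ 2 μ) (b.sum_repr u)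
        simpa using this
      have h2 : ∑ k, (b.repr u k) • (b k : Lp ℂ 2 μ) =
          ∑ j, (∑ k, b.repr u k * β k j) • e j := by
        simp only [← hβ, Finset.smul_sum, Finset.sum_smul, mul_smul]
        exact Finset.sum_comm
      have h3 : expSum ξ a =ᵐ[μ] expSum ξ fun j => ∑ k, b.repr u k * β k j := by
        rw [← MemLp.toLp_eq_toLp_iff (memLp_expSum ξ a (p := 2)) (memLp_expSum ξ _)]
        exact h1.symm.trans (h2.trans (sum_smul_toLp_expChar ξ _))
      -- Equality in L² of the ball becomes equality at every point, since both sides are continuous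
      -- and the ball is open.
      intro y hy
      rw [Measure.eqOn_open_of_ae_eq h3 isOpen_ball (continuous_expSum ξ a).continuousOn
        (continuous_expSum ξ _).continuousOn hy]
      simp only [expSum, Finset.mul_sum, Finset.sum_mul, mul_assoc]
      exact Finset.sum_comm
    · rw [← norm_toLp_sq_eq_integral (memLp_expSum ξ a)]
      rw [← EuclideanSpace.norm_sq_eq (b.repr u), b.repr.norm_map u]
      rfl

/-- An exponential sum of `N` frequencies is controlled at the points of a ball by its mean square
over the tripled ball, with a loss of `N`. -/
lemma norm_expSum_sq_le (ξ : Fin N → Rn n) (a : Fin N → ℂ) {c x : Rn n} {r : ℝ}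
    (hx : x ∈ ball c r) :
    ‖expSum ξ a x‖ ^ 2 * volume.real (ball (0 : Rn n) r) ≤
      N * ∫ y in ball c (3 * r), ‖expSum ξ a y‖ ^ 2 := by
  obtain ⟨m, β, hm, hβ, hrep⟩ := exists_orthonormal_expSum ξ r
  set I := ∫ y in ball c (3 * r), ‖expSum ξ a y‖ ^ 2 with hI
  have hint : ∀ (a : Fin N → ℂ) (x : Rn n) (r : ℝ),
      IntegrableOn (fun y => ‖expSum ξ a y‖ ^ 2) (ball x r) := fun a x r =>
    (memLp_expSum ξ a (p := 2)).integrable_norm_pow (by norm_num)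
  have hI0 : 0 ≤ I := integral_nonneg fun _ => by positivity
  -- Writing x = y + (x - y), the sum translated by x - y is expanded at y in the basis and
  -- Cauchy–Schwarz applies. The translated ball stays in the tripled one because |x - y - c| < 2r.
  -- Averaging over y replaces the sum of squares of the basis by its integral, the dimension m ≤ N.
  have key : ∀ y ∈ ball (0 : Rn n) r,
      ‖expSum ξ a x‖ ^ 2 ≤ I * ∑ k, ‖expSum ξ (β k) y‖ ^ 2 := by
    intro y hy
    obtain ⟨c', h1, h2⟩ := hrep fun j => a j * expChar (ξ j) (x - y)
    have h3 := h1 y hy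
    rw [expSum_translate, add_sub_cancel] at h3
    simp only [expSum_translate] at h2
    have h4 : ∫ z in ball (0 : Rn n) r, ‖expSum ξ a (z + (x - y))‖ ^ 2 ≤ I := by
      have h5 : ball (0 : Rn n) r = (fun z => z + (x - y)) ⁻¹' ball (x - y) r := by
        ext z; simp [dist_eq_norm]
      rw [h5, (measurePreserving_add_right volume (x - y)).setIntegral_preimage_emb
        (measurableEmbedding_addRight _) (fun z => ‖expSum ξ a z‖ ^ 2)]
      refine setIntegral_mono_set (hint a _ _) (ae_of_all _ fun _ => by positivity) ?_
      refine (ball_subset_ball' ?_).eventuallyLE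
      rw [mem_ball, dist_eq_norm] at hx hy
      have : dist (x - y) c ≤ ‖x - c‖ + ‖y - 0‖ := by
        rw [dist_eq_norm, sub_zero, show x - y - c = (x - c) - y by abel]
        exact norm_sub_le _ _
      linarith
    calc ‖expSum ξ a x‖ ^ 2 ≤ (∑ k, ‖c' k‖ * ‖expSum ξ (β k) y‖) ^ 2 := by
          rw [h3]
          gcongr
          refine (norm_sum_le _ _).trans (Finset.sum_le_sum fun k _ => ?_)
          rw [norm_mul]
      _ ≤ (∑ k, ‖c' k‖ ^ 2) * ∑ k, ‖expSum ξ (β k) y‖ ^ 2 := Finset.sum_mul_sq_le_sq_mul_sq _ _ _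
      _ ≤ _ := by
          rw [h2]
          gcongr
  have h6 : ∫ y in ball (0 : Rn n) r, ‖expSum ξ a x‖ ^ 2 ≤
      ∫ y in ball (0 : Rn n) r, I * ∑ k, ‖expSum ξ (β k) y‖ ^ 2 := by
    refine setIntegral_mono_on (integrable_const _) ?_ measurableSet_ball key
    exact (integrable_finsetSum _ fun k _ => hint (β k) 0 r).const_mul I
  rw [setIntegral_const, smul_eq_mul, integral_const_mul,
    integral_finsetSum _ fun k _ => hint (β k) 0 r] at h6
  simp only [hβ, Finset.sum_const, Finset.card_univ, Fintype.card_fin, nsmul_eq_mul, mul_one] at h6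
  calc _ ≤ I * m := by rw [mul_comm]; exact h6
    _ ≤ I * N := by gcongr
    _ = _ := mul_comm _ _

/-- A square-integrable function in a ball has the same moments against `N` exponentials as a
function in the tripled ball whose `L²` norm is controlled by the `L¹` norm. -/
lemma exists_same_moments (ξ : Fin N → Rn n) {c : Rn n} {r : ℝ}
    {h : Rn n → ℂ} (hh : MemLp h 2 volume) (hs : ∀ x ∉ ball c r, h x = 0) :
    ∃ φ : Rn n → ℂ, MemLp φ 2 volume ∧ (∀ x ∉ ball c (3 * r), φ x = 0) ∧
      (∀ j, ∫ y, conj (expChar (ξ j) y) * (h y - φ y) = 0) ∧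
      (∫ y, ‖φ y‖ ^ 2) * volume.real (ball (0 : Rn n) r) ≤ N * (∫ y, ‖h y‖) ^ 2 := by
  have hrr : ball c r ⊆ ball c (3 * r) := by
    intro x hx
    have : 0 < r := pos_of_mem_ball hx
    exact ball_subset_ball (by linarith) hx
  obtain ⟨S, hS⟩ : ∃ S, S = ball c (3 * r) := ⟨_, rfl⟩
  have hSm : MeasurableSet S := hS ▸ measurableSet_ball
  rw [← hS] at hrr ⊢
  set μ := (volume : Measure (Rn n)).restrict S with hμ
  have : IsFiniteMeasure μ := by rw [hμ, hS]; infer_instance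
  let e : Fin N → Lp ℂ 2 μ := fun j => (memLp_expChar (ξ j)).toLp (expChar (ξ j))
  let W := Submodule.span ℂ (Set.range e)
  have hhμ : MemLp h 2 μ := hh.restrict _
  let H : Lp ℂ 2 μ := hhμ.toLp h
  have : FiniteDimensional ℂ W := FiniteDimensional.span_of_finite ℂ (Set.finite_range e)
  obtain ⟨a, ha⟩ := (Submodule.mem_span_range_iff_exists_fun ℂ).1 (W.starProjection_apply_mem H)
  have hP : W.starProjection H = (memLp_expSum ξ a).toLp (expSum ξ a) := by
    rw [← ha, sum_smul_toLp_expChar]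
  have horth : ∀ w ∈ W, inner ℂ w (H - W.starProjection H) = 0 := fun w hw =>
    W.starProjection_inner_eq_zero H w hw ▸ by
      rw [← inner_conj_symm, W.starProjection_inner_eq_zero H w hw, map_zero]
  have hsub : H - W.starProjection H = (hhμ.sub (memLp_expSum ξ a)).toLp (h - expSum ξ a) := by
    rw [hP, MemLp.toLp_sub]
  have hφ : MemLp (S.indicator (expSum ξ a)) 2 volume :=
    (memLp_indicator_iff_restrict hSm).2 (memLp_expSum ξ a)
  refine ⟨S.indicator (expSum ξ a), hφ, fun x hx => indicator_of_notMem hx _, fun j => ?_, ?_⟩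
  · have h1 := horth (e j) (Submodule.subset_span (mem_range_self j))
    rw [hsub, inner_toLp_eq_integral] at h1
    rw [← h1, ← integral_indicator hSm]
    congr 1 with y
    by_cases hy : y ∈ S
    · simp [hy]
    · simp [hy, hs y (fun h => hy (hrr h))]
  · have h2 : inner ℂ (W.starProjection H) H = ((∫ y in S, ‖expSum ξ a y‖ ^ 2 : ℝ) : ℂ) := by
      have h3 := horth _ (W.starProjection_apply_mem H)
      rw [inner_sub_right, sub_eq_zero] at h3
      rw [h3, inner_self_eq_norm_sq_to_K, hP, ← norm_toLp_sq_eq_integral (memLp_expSum ξ a)]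
      rw [Complex.ofReal_pow]
      rfl
    have hφI : ∫ y, ‖S.indicator (expSum ξ a) y‖ ^ 2 = ∫ y in S, ‖expSum ξ a y‖ ^ 2 := by
      rw [← integral_indicator hSm]
      congr 1 with y
      by_cases hy : y ∈ S <;> simp [hy]
    rw [hφI]
    set I := ∫ y in S, ‖expSum ξ a y‖ ^ 2 with hI
    have hI0 : 0 ≤ I := integral_nonneg fun _ => by positivity
    set v := volume.real (ball (0 : Rn n) r)
    have hv : 0 ≤ v := measureReal_nonneg
    have hint : Integrable h := by
      have h4 : IntegrableOn h (ball c r) :=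
        (hh.restrict _).integrable (by norm_num)
      refine (integrableOn_iff_integrable_of_support_subset ?_).1 h4
      intro x hx
      by_contra h'
      exact hx (hs x h')
    -- Since φ is a projection of h, I = ‖φ‖² = ⟨φ, h⟩ is at most ‖h‖₁ times the supremum of |φ| on
    -- the small ball, where h lives. That supremum is at most √(N I / v); squaring and cancelling
    -- one factor I concludes.
    have h5 : I * Real.sqrt v ≤ Real.sqrt (N * I) * ∫ y, ‖h y‖ := by
      have h6 : I = ‖inner ℂ (W.starProjection H) H‖ := by
        rw [h2, Complex.norm_real, Real.norm_of_nonneg hI0]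
      conv_lhs => rw [h6]
      rw [hP, inner_toLp_eq_integral]
      have h7 : ‖∫ y in S, conj (expSum ξ a y) * h y‖ ≤ ∫ y in S, ‖expSum ξ a y‖ * ‖h y‖ := by
        refine (norm_integral_le_integral_norm _).trans (le_of_eq ?_)
        simp
      refine (mul_le_mul_of_nonneg_right h7 (Real.sqrt_nonneg _)).trans ?_
      rw [← integral_mul_const, ← integral_const_mul]
      refine (integral_mono_of_nonneg (ae_of_all _ fun y => by positivity)
        (g := fun y => Real.sqrt (N * I) * ‖h y‖) (hint.norm.const_mul _).restrict
        (ae_of_all _ fun y => ?_)).trans ?_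
      · by_cases hy : y ∈ ball c r
        · have h8 := norm_expSum_sq_le ξ a hy
          have : ‖expSum ξ a y‖ * Real.sqrt v ≤ Real.sqrt (N * I) := by
            refine Real.le_sqrt_of_sq_le ?_
            rw [mul_pow, Real.sq_sqrt hv]
            rw [← hS] at h8
            exact h8
          calc ‖expSum ξ a y‖ * ‖h y‖ * Real.sqrt v = (‖expSum ξ a y‖ * Real.sqrt v) * ‖h y‖ := by
                ring
            _ ≤ _ := mul_le_mul_of_nonneg_right this (norm_nonneg _)
        · simp [hs y hy]
      · exact setIntegral_le_integral (hint.norm.const_mul _) (ae_of_all _ fun y => by positivity)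
    have hM : 0 ≤ ∫ y, ‖h y‖ := integral_nonneg fun _ => norm_nonneg _
    have h9 : I ^ 2 * v ≤ (N * I) * (∫ y, ‖h y‖) ^ 2 := by
      have := pow_le_pow_left₀ (by positivity) h5 2
      rw [mul_pow, mul_pow, Real.sq_sqrt hv, Real.sq_sqrt (by positivity)] at this
      exact this
    rcases hI0.eq_or_lt with h0 | h0
    · rw [← h0, zero_mul]; positivity
    · refine le_of_mul_le_mul_left ?_ h0
      linarith
end Exponentials

/-! ### Maximal function, Whitney covering and partition of unity. -/

section Covering

variable {n : ℕ}

lemma measure_ball_mul (x : Rn n) {t : ℝ} (ht : 0 < t) (r : ℝ) :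
    (volume : Measure (Rn n)) (ball x (t * r)) =
      ENNReal.ofReal (t ^ n) * volume (ball (0 : Rn n) r) := by
  rw [Measure.addHaar_ball_mul_of_pos _ _ ht, finrank_euclideanSpace, Fintype.card_fin]

lemma measureReal_ball_mul (x : Rn n) {t : ℝ} (ht : 0 < t) (r : ℝ) :
    (volume : Measure (Rn n)).real (ball x (t * r)) = t ^ n * volume.real (ball (0 : Rn n) r) := by
  rw [measureReal_def, measure_ball_mul x ht, ENNReal.toReal_mul, ENNReal.toReal_ofReal (by positivity),
    measureReal_def]

lemma measureReal_ball_center (x : Rn n) (r : ℝ) :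
    (volume : Measure (Rn n)).real (ball x r) = volume.real (ball (0 : Rn n) r) := by
  simpa using measureReal_ball_mul x one_pos r

lemma measureReal_ball_pos (x : Rn n) {r : ℝ} (hr : 0 < r) :
    0 < (volume : Measure (Rn n)).real (ball x r) :=
  ENNReal.toReal_pos (measure_ball_pos _ _ hr).ne' measure_ball_lt_top.ne

/-- Balls of bounded volume have bounded radius. -/
lemma exists_radius_bound [Nontrivial (Rn n)] (M : ℝ) :
    ∃ R : ℝ, ∀ (x : Rn n) (r : ℝ), volume.real (ball x r) ≤ M → r ≤ R := by
  have hn : n ≠ 0 := by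
    rintro rfl
    exact not_subsingleton (Rn 0) inferInstance
  set v := volume.real (ball (0 : Rn n) 1)
  have hv : 0 < v := measureReal_ball_pos 0 one_pos
  refine ⟨max 1 (M / v), fun x r h => ?_⟩
  by_contra! hr
  have h1 : 1 < r := (le_max_left _ _).trans_lt hr
  have h2 := measureReal_ball_mul x (one_pos.trans h1) 1
  rw [mul_one] at h2
  rw [h2] at h
  have h3 : r ≤ r ^ n := le_self_pow₀ h1.le hn
  have h4 : r ≤ M / v := h3.trans ((le_div_iff₀ hv).2 h)
  exact absurd (h4.trans (le_max_right _ _)) (not_le.2 hr)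

/-- The union of the balls in which the mean of `‖f‖` exceeds `s`. -/
def maximalLevelSet (f : Rn n → ℂ) (s : ℝ) : Set (Rn n) :=
  {x | ∃ z r, 0 < r ∧ x ∈ ball z r ∧ s * volume.real (ball z r) < ∫ y in ball z r, ‖f y‖}

lemma isOpen_maximalLevelSet (f : Rn n → ℂ) (s : ℝ) : IsOpen (maximalLevelSet f s) := by
  rw [isOpen_iff_mem_nhds]
  rintro x ⟨z, r, hr, hx, h⟩
  exact mem_of_superset (isOpen_ball.mem_nhds hx) fun y hy => ⟨z, r, hr, hy, h⟩

lemma setIntegral_ball_le_of_notMem {f : Rn n → ℂ} {s : ℝ} {x z : Rn n} {r : ℝ}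
    (hx : x ∉ maximalLevelSet f s) (hz : x ∈ ball z r) :
    ∫ y in ball z r, ‖f y‖ ≤ s * volume.real (ball z r) := by
  by_contra! h
  exact hx ⟨z, r, pos_of_mem_ball hz, hz, h⟩

/-- Vitali's covering argument. The radii are bounded, as it requires, because each admissible ball
has volume at most ‖f‖₁ / s. -/
lemma volume_maximalLevelSet_le [Nontrivial (Rn n)] {f : Rn n → ℂ} (hf : Integrable f) {s : ℝ}
    (hs : 0 < s) :
    volume (maximalLevelSet f s) ≤ ENNReal.ofReal (5 ^ n * (∫ y, ‖f y‖) / s) := by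
  let t : Set (Rn n × ℝ) := {p | 0 < p.2 ∧
    s * volume.real (ball p.1 p.2) < ∫ y in ball p.1 p.2, ‖f y‖}
  obtain ⟨R, hR⟩ := exists_radius_bound (n := n) ((∫ y, ‖f y‖) / s)
  have htR : ∀ p ∈ t, p.2 ≤ R := fun p hp => by
    refine hR p.1 p.2 ?_
    rw [le_div_iff₀ hs, mul_comm]
    exact hp.2.le.trans (setIntegral_le_integral hf.norm (ae_of_all _ fun _ => norm_nonneg _))
  obtain ⟨u, hut, hdisj, hcov⟩ :=
    Vitali.exists_disjoint_subfamily_covering_enlargement_closedBall t Prod.fst Prod.snd R htR 5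
      (by norm_num)
  have hcount : u.Countable := by
    refine hdisj.countable_of_nonempty_interior fun p hp => ?_
    exact (nonempty_ball.2 (hut hp).1).mono ball_subset_interior_closedBall
  have hsub : maximalLevelSet f s ⊆ ⋃ p ∈ u, closedBall p.1 (5 * p.2) := by
    rintro x ⟨z, r, hr, hx, h⟩
    obtain ⟨p, hp, hp'⟩ := hcov (z, r) ⟨hr, h⟩
    exact mem_biUnion hp (hp' (ball_subset_closedBall hx))
  have hdisj' : u.PairwiseDisjoint fun p => ball p.1 p.2 :=
    hdisj.mono fun p => ball_subset_closedBall
  have hball : ∀ p ∈ u, volume (closedBall p.1 (5 * p.2)) ≤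
      ENNReal.ofReal (5 ^ n / s) * ∫⁻ y in ball p.1 p.2, ‖f y‖ₑ := by
    intro p hp
    have h1 := (hut hp).2
    rw [Measure.addHaar_closedBall_eq_addHaar_ball, measure_ball_mul _ (by norm_num)]
    have h2 : ∫⁻ y in ball p.1 p.2, ‖f y‖ₑ = ENNReal.ofReal (∫ y in ball p.1 p.2, ‖f y‖) :=
      (ofReal_integral_norm_eq_lintegral_enorm hf.integrableOn).symm
    rw [h2, ← ENNReal.ofReal_mul (by positivity), ← ofReal_measureReal measure_ball_lt_top.ne,
      ← ENNReal.ofReal_mul (by positivity), ← measureReal_ball_center p.1]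
    refine ENNReal.ofReal_le_ofReal ?_
    rw [div_mul_eq_mul_div, le_div_iff₀ hs, mul_assoc]
    gcongr
    rw [mul_comm]
    exact h1.le
  calc volume (maximalLevelSet f s) ≤ volume (⋃ p ∈ u, closedBall p.1 (5 * p.2)) :=
        measure_mono hsub
    _ ≤ ∑' p : u, volume (closedBall p.1.1 (5 * p.1.2)) := measure_biUnion_le _ hcount _
    _ ≤ ∑' p : u, ENNReal.ofReal (5 ^ n / s) * ∫⁻ y in ball p.1.1 p.1.2, ‖f y‖ₑ :=
        ENNReal.tsum_le_tsum fun p => hball p.1 p.2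
    _ = ENNReal.ofReal (5 ^ n / s) * ∫⁻ y in ⋃ p ∈ u, ball p.1 p.2, ‖f y‖ₑ := by
        rw [ENNReal.tsum_mul_left, lintegral_biUnion hcount (fun _ _ => measurableSet_ball) hdisj']
    _ ≤ ENNReal.ofReal (5 ^ n / s) * ∫⁻ y, ‖f y‖ₑ := by
        gcongr
        exact Measure.restrict_le_self
    _ = _ := by
        rw [← ofReal_integral_norm_eq_lintegral_enorm hf, ← ENNReal.ofReal_mul (by positivity)]
        congr 1
        ring

/-- Outside of the level set of the maximal function, the function is bounded by the level. -/
lemma ae_norm_le_of_notMem_maximalLevelSet [Nontrivial (Rn n)] {f : Rn n → ℂ} (hf : Integrable f)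
    (s : ℝ) : ∀ᵐ x, x ∉ maximalLevelSet f s → ‖f x‖ ≤ s := by
  filter_upwards [IsUnifLocDoublingMeasure.ae_tendsto_average volume
    hf.norm.locallyIntegrable 0] with x hx hxΩ
  refine le_of_tendsto (hx (l := nhdsWithin 0 (Ioi 0)) (fun _ : ℝ => x) id tendsto_id ?_) ?_
  · exact Eventually.of_forall fun r => by simp
  · filter_upwards [self_mem_nhdsWithin] with r (hr : 0 < r)
    have h1 : (closedBall x r : Set (Rn n)) =ᵐ[volume] ball x r :=
      (ae_eq_of_subset_of_measure_ge ball_subset_closedBall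
        (Measure.addHaar_closedBall_eq_addHaar_ball _ _ _).le measurableSet_ball.nullMeasurableSet
        measure_closedBall_lt_top.ne).symm
    have hv := measureReal_ball_pos x hr
    rw [id, setAverage_congr h1, setAverage_eq, smul_eq_mul, inv_mul_le_iff₀ hv, mul_comm]
    exact setIntegral_ball_le_of_notMem hxΩ (mem_ball_self hr)

/-- A Whitney covering: disjoint balls whose quintuples cover the open set `Ω`, with radii
comparable to the distance to the complement. -/
lemma exists_whitney_covering [Nontrivial (Rn n)] {Ω : Set (Rn n)} (hΩ : IsOpen Ω)
    (hne : Ωᶜ.Nonempty) (hfin : volume Ω ≠ ∞) :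
    ∃ u : Set (Rn n), u ⊆ Ω ∧ u.PairwiseDisjoint (fun x => closedBall x (infDist x Ωᶜ / 30)) ∧
      Ω ⊆ ⋃ x ∈ u, ball x (5 * (infDist x Ωᶜ / 30)) := by
  have hball : ∀ x, ball x (infDist x Ωᶜ) ⊆ Ω := fun x =>
    disjoint_compl_right_iff_subset.1 disjoint_ball_infDist
  obtain ⟨R, hR⟩ := exists_radius_bound (n := n) (volume.real Ω)
  have hpos : ∀ x ∈ Ω, 0 < infDist x Ωᶜ := fun x hx =>
    (hΩ.isClosed_compl.notMem_iff_infDist_pos hne).1 (by simpa using hx)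
  obtain ⟨u, hu, hdisj, hcov⟩ :=
    Vitali.exists_disjoint_subfamily_covering_enlargement_closedBall Ω (id : Rn n → Rn n)
      (fun x => infDist x Ωᶜ / 30) R (fun x _ => by
        have := hR x _ (measureReal_mono (hball x) hfin)
        have h0 : 0 ≤ infDist x Ωᶜ := infDist_nonneg
        linarith) 4 (by norm_num)
  refine ⟨u, hu, hdisj, fun x hx => ?_⟩
  obtain ⟨y, hy, hxy⟩ := hcov x hx
  -- Vitali with factor 4 leaves room for open balls with factor 5; openness is needed to extract
  -- finite subcovers.
  refine mem_biUnion hy (closedBall_subset_ball ?_ (hxy (mem_closedBall_self ?_)))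
  · have := hpos y (hu hy); linarith
  · have := hpos x hx; positivity

/-- Bounded overlap of the enlarged Whitney balls. -/
lemma whitney_overlap_le {Ω : Set (Rn n)} {F : Finset (Rn n)}
    (hpos : ∀ x ∈ F, 0 < infDist x Ωᶜ)
    (hdisj : (F : Set (Rn n)).PairwiseDisjoint (fun x => closedBall x (infDist x Ωᶜ / 30)))
    (y : Rn n) [DecidablePred fun x => y ∈ ball x (15 * (infDist x Ωᶜ / 30))] :
    ((F.filter fun x => y ∈ ball x (15 * (infDist x Ωᶜ / 30))).card : ℝ) ≤ 48 ^ n := by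
  set G := F.filter fun x => y ∈ ball x (15 * (infDist x Ωᶜ / 30)) with hG
  rcases G.eq_empty_or_nonempty with h0 | ⟨x₀, hx₀⟩
  · rw [h0]; simp
  set δ := infDist y Ωᶜ
  -- With ρ = d(x)/30 and |x - y| < 15ρ, the distance δ of y to the complement lies between 15ρ and
  -- 45ρ. The disjoint balls of radius ρ > δ/45 lie in the ball about y of radius 16ρ < 48 · δ/45,
  -- which gives 48 ^ n by volume.
  have hcomp : ∀ x ∈ G, infDist x Ωᶜ / 30 < δ / 15 ∧ δ / 45 < infDist x Ωᶜ / 30 := by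
    intro x hx
    have hy := mem_ball.1 (Finset.mem_filter.1 hx).2
    have h1 : infDist x Ωᶜ ≤ δ + dist x y := infDist_le_infDist_add_dist
    have h2 : δ ≤ infDist x Ωᶜ + dist y x := infDist_le_infDist_add_dist
    rw [dist_comm] at h1
    constructor <;> linarith
  have hδ : 0 < δ := by
    have h1 := hcomp x₀ hx₀
    have h2 := hpos x₀ (Finset.mem_filter.1 hx₀).1
    linarith
  set v := volume.real (ball (0 : Rn n) (δ / 45))
  have hv : 0 < v := measureReal_ball_pos 0 (by positivity)
  have h1 : ∑ x ∈ G, volume.real (ball x (infDist x Ωᶜ / 30)) ≤ 48 ^ n * v := by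
    rw [← measureReal_ball_mul y (by norm_num)]
    rw [← measureReal_biUnion_finset ?_ (fun _ _ => measurableSet_ball)
      (fun _ _ => measure_ball_lt_top.ne)]
    · refine measureReal_mono (iUnion₂_subset fun x hx => ?_) measure_ball_lt_top.ne
      refine ball_subset_ball' ?_
      have h2 := hcomp x hx
      have h3 := mem_ball.1 (Finset.mem_filter.1 hx).2
      rw [dist_comm] at h3
      linarith
    · intro a ha b hb hab
      refine (hdisj (Finset.mem_filter.1 ha).1 (Finset.mem_filter.1 hb).1 hab).mono ?_ ?_ <;>
        exact ball_subset_closedBall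
  have h2 : G.card * v ≤ ∑ x ∈ G, volume.real (ball x (infDist x Ωᶜ / 30)) := by
    rw [← nsmul_eq_mul]
    refine Finset.card_nsmul_le_sum _ _ _ fun x hx => ?_
    rw [measureReal_ball_center]
    exact measureReal_mono (ball_subset_ball (hcomp x hx).2.le) measure_ball_lt_top.ne
  exact le_of_mul_le_mul_right (h2.trans h1) hv

/-- A finite part of an open cover that exhausts a set up to a small measure. -/
lemma exists_finset_measure_diff_lt {ν : Measure (Rn n)} [IsFiniteMeasure ν] {Ω u : Set (Rn n)}
    (hΩ : IsOpen Ω) {b : Rn n → Set (Rn n)} (hb : ∀ x, IsOpen (b x)) (hu : Ω ⊆ ⋃ x ∈ u, b x)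
    {ε : ℝ≥0∞} (hε : ε ≠ 0) :
    ∃ F : Finset (Rn n), (F : Set (Rn n)) ⊆ u ∧ ν (Ω \ ⋃ x ∈ F, b x) < ε := by
  obtain ⟨K, hKΩ, hK, hlt⟩ := hΩ.measurableSet.exists_isCompact_sdiff_lt (measure_ne_top ν Ω) hε
  obtain ⟨F, hFu, hF, hKF⟩ := hK.elim_finite_subcover_image (fun x _ => hb x) (hKΩ.trans hu)
  refine ⟨hF.toFinset, by simpa using hFu, lt_of_le_of_lt (measure_mono ?_) hlt⟩
  refine sdiff_subset_sdiff_right ?_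
  simpa using hKF

lemma exists_partition_weights {ι α : Type*} [MeasurableSpace α] (F : Finset ι) (b : ι → Set α)
    (hb : ∀ i, MeasurableSet (b i)) :
    ∃ w : ι → α → ℝ, (∀ i, Measurable (w i)) ∧ (∀ i y, 0 ≤ w i y) ∧
      (∀ i y, w i y ≤ 1) ∧ (∀ i, ∀ y ∉ b i, w i y = 0) ∧
      ∀ y, ∑ i ∈ F, w i y = (⋃ i ∈ F, b i).indicator 1 y := by
  have hnn : ∀ i y, 0 ≤ (b i).indicator (1 : α → ℝ) y := fun i y =>
    indicator_nonneg (fun _ _ => zero_le_one) y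
  have hzero : ∀ y, y ∉ ⋃ i ∈ F, b i → ∑ k ∈ F, (b k).indicator (1 : α → ℝ) y = 0 := by
    refine fun y hy => Finset.sum_eq_zero fun k hk => indicator_of_notMem (fun h => hy ?_) _
    exact mem_iUnion₂.2 ⟨k, hk, h⟩
  -- Off the union the denominator is 0 and the quotient is 0 by convention, so the bounds hold for
  -- every index, including those outside `F`.
  refine ⟨fun i y => (b i).indicator 1 y / ∑ k ∈ F, (b k).indicator (1 : α → ℝ) y, fun i => ?_,
    fun i y => ?_, fun i y => ?_, fun i y hy => ?_, fun y => ?_⟩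
  · have h : ∀ i, Measurable ((b i).indicator (1 : α → ℝ)) := fun i =>
      measurable_one.indicator (hb i)
    exact (h i).div (Finset.measurable_fun_sum _ fun k _ => h k)
  · exact div_nonneg (hnn i y) (Finset.sum_nonneg fun k _ => hnn k y)
  · by_cases hy : y ∈ ⋃ i ∈ F, b i
    · obtain ⟨k, hk, hyk⟩ := mem_iUnion₂.1 hy
      refine div_le_one_of_le₀ ?_ (Finset.sum_nonneg fun k _ => hnn k y)
      refine le_trans ?_ (Finset.single_le_sum
        (f := fun k => (b k).indicator (1 : α → ℝ) y) (fun k _ => hnn k y) hk)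
      rw [indicator_of_mem hyk]
      exact indicator_le_self' (fun _ _ => zero_le_one) y
    · simp only [hzero y hy, div_zero]
      exact zero_le_one
  · simp [hy]
  · rw [← Finset.sum_div]
    by_cases hy : y ∈ ⋃ i ∈ F, b i
    · rw [indicator_of_mem hy, Pi.one_apply]
      refine div_self (ne_of_gt ?_)
      obtain ⟨i, hi, hyi⟩ := mem_iUnion₂.1 hy
      refine lt_of_lt_of_le ?_ (Finset.single_le_sum
        (f := fun k => (b k).indicator (1 : α → ℝ) y) (fun k _ => hnn k y) hi)
      simp [hyi]
    · rw [indicator_of_notMem hy]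
      rw [hzero y hy, div_zero]

end Covering

/-! ### Off-diagonal kernels, adjoints and cancellation. -/

section Kernels

variable {n N : ℕ}

lemma expChar_sub (ξ x y : Rn n) : expChar ξ (x - y) = expChar ξ x * conj (expChar ξ y) := by
  rw [conj_expChar, expChar, expChar, ← Complex.exp_add, inner_sub_right]
  push_cast
  ring_nf

lemma eq_expChar_mul_modulatedKernel (ξ : Rn n) (K : Rn n → Rn n → ℂ) (x y : Rn n) :
    K x y = expChar ξ (x - y) * modulatedKernel ξ K (x, y) := by
  rw [modulatedKernel, expChar, ← mul_assoc, ← Complex.exp_add]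
  simp

/-- `T` is given by the kernel `k` when tested on functions with disjoint compact supports. -/
def HasWeakKernel (T : LpRn n 2 →L[ℂ] LpRn n 2) (k : Rn n × Rn n → ℂ) : Prop :=
  ∀ (f g : Rn n → ℂ) (hf : MemLp f 2 volume) (hg : MemLp g 2 volume), HasCompactSupport f →
    HasCompactSupport g → Disjoint (tsupport f) (tsupport g) →
      inner ℂ (hg.toLp g) (T (hf.toLp f)) = ∫ z, conj (g z.1) * (k z * f z.2)

/-- The sum of a family of kernels. -/
def kernelSum (K : Fin N → Rn n → Rn n → ℂ) (z : Rn n × Rn n) : ℂ := ∑ j, K j z.1 z.2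

lemma integrable_of_memLp_of_hasCompactSupport {f : Rn n → ℂ} (hf : MemLp f 2 volume)
    (hc : HasCompactSupport f) : Integrable f := by
  have : IsFiniteMeasure ((volume : Measure (Rn n)).restrict (tsupport f)) :=
    isFiniteMeasure_restrict.2 hc.isCompact.measure_lt_top.ne
  exact (integrableOn_iff_integrable_of_support_subset (subset_tsupport f)).1
    ((hf.restrict _).integrable (by norm_num))

lemma continuousAt_kernel {ξ : Fin N → Rn n} {K : Fin N → Rn n → Rn n → ℂ} {A : ℝ}
    (hK : JointGradientBound ξ K A) (j : Fin N) {z : Rn n × Rn n} (hz : z.1 ≠ z.2) :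
    ContinuousAt (fun z : Rn n × Rn n => K j z.1 z.2) z := by
  have h1 : (fun z : Rn n × Rn n => K j z.1 z.2) =
      fun z => expChar (ξ j) (z.1 - z.2) * modulatedKernel (ξ j) (K j) z := by
    ext z
    exact eq_expChar_mul_modulatedKernel _ _ _ _
  rw [h1]
  refine ContinuousAt.mul ?_ ((hK z.1 z.2 hz).1 j).continuousAt
  exact ((continuous_expChar (ξ j)).comp (continuous_fst.sub continuous_snd)).continuousAt

lemma continuousAt_kernelSum {ξ : Fin N → Rn n} {K : Fin N → Rn n → Rn n → ℂ} {A : ℝ}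
    (hK : JointGradientBound ξ K A) {z : Rn n × Rn n} (hz : z.1 ≠ z.2) :
    ContinuousAt (kernelSum K) z :=
  tendsto_finsetSum _ fun j _ => continuousAt_kernel hK j hz

lemma integrable_kernel_section {k : Rn n × Rn n → ℂ}
    (hk : ∀ z : Rn n × Rn n, z.1 ≠ z.2 → ContinuousAt k z) {f : Rn n → ℂ}
    (hf : Integrable f) (hc : HasCompactSupport f) {x : Rn n} (hx : x ∉ tsupport f) :
    Integrable fun y => k (x, y) * f y := by
  refine (integrableOn_iff_integrable_of_support_subset (s := tsupport f) ?_).1 ?_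
  · intro y hy
    exact subset_tsupport f (right_ne_zero_of_mul hy)
  · refine IntegrableOn.continuousOn_mul (fun y hy => ContinuousAt.continuousWithinAt ?_)
      hf.integrableOn hc.isCompact
    have h : x ≠ y := fun h => hx (h ▸ hy)
    exact (hk (x, y) h).comp (f := fun y => (x, y)) (by fun_prop)

/-- Disjoint compact supports keep the product of the supports in a compact set off the diagonal,
where the kernel is continuous and so bounded. This justifies Fubini. -/
lemma integrable_kernel_prod {k : Rn n × Rn n → ℂ}
    (hk : ∀ z : Rn n × Rn n, z.1 ≠ z.2 → ContinuousAt k z) {f g : Rn n → ℂ}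
    (hf : Integrable f) (hg : Integrable g) (hfc : HasCompactSupport f) (hgc : HasCompactSupport g)
    (hd : Disjoint (tsupport f) (tsupport g)) :
    Integrable fun z : Rn n × Rn n => conj (g z.1) * (k z * f z.2) := by
  have hG : Integrable fun z : Rn n × Rn n => conj (g z.1) * f z.2 := by
    have hg' : Integrable fun x => conj (g x) := by
      refine hg.congr' ?_ (ae_of_all _ fun x => by simp)
      exact Complex.continuous_conj.comp_aestronglyMeasurable hg.1
    exact hg'.mul_prod hf
  have h : (fun z : Rn n × Rn n => conj (g z.1) * (k z * f z.2)) =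
      fun z => k z * (conj (g z.1) * f z.2) := by
    ext z; ring
  rw [h]
  refine (integrableOn_iff_integrable_of_support_subset (s := tsupport g ×ˢ tsupport f) ?_).1 ?_
  · intro z hz
    have h1 := right_ne_zero_of_mul hz
    refine ⟨subset_tsupport g ?_, subset_tsupport f (right_ne_zero_of_mul h1)⟩
    simpa using left_ne_zero_of_mul h1
  · refine IntegrableOn.continuousOn_mul (fun z hz => ContinuousAt.continuousWithinAt (hk z ?_))
      hG.integrableOn (hgc.isCompact.prod hfc.isCompact)
    exact fun h => disjoint_left.1 hd (h ▸ hz.2) hz.1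

/-- The unbounded pieces `S j` are traded for a statement about the bounded operator T alone, which,
unlike them, has an adjoint. -/
lemma hasWeakKernel_kernelSum {ξ : Fin N → Rn n} {K : Fin N → Rn n → Rn n → ℂ} {A : ℝ}
    {T : LpRn n 2 →L[ℂ] LpRn n 2} {S : Fin N → LpRn n 2 →ₗ[ℂ] (Rn n →ₘ[volume] ℂ)}
    (hT : ∀ f : LpRn n 2, (T f : Rn n →ₘ[volume] ℂ) = ∑ j, S j f)
    (hS : ∀ j, HasOffDiagonalKernel (S j) (K j)) (hK : JointGradientBound ξ K A) :
    HasWeakKernel T (kernelSum K) := by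
  intro f g hf hg hfc hgc hd
  have hfi := integrable_of_memLp_of_hasCompactSupport hf hfc
  have hgi := integrable_of_memLp_of_hasCompactSupport hg hgc
  have hk : ∀ z : Rn n × Rn n, z.1 ≠ z.2 → ContinuousAt (kernelSum K) z := fun z hz =>
    continuousAt_kernelSum hK hz
  have hint := integrable_kernel_prod hk hfi hgi hfc hgc hd
  rw [Measure.volume_eq_prod] at hint ⊢
  rw [integral_prod _ hint, L2.inner_def]
  refine integral_congr_ae ?_
  have hsum : (T (hf.toLp f) : Rn n → ℂ) =ᵐ[volume] fun x => ∑ j, S j (hf.toLp f) x := by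
    have h1 : (T (hf.toLp f) : Rn n → ℂ) =ᵐ[volume] (∑ j, S j (hf.toLp f) : Rn n →ₘ[volume] ℂ) := by
      rw [← hT]
    refine h1.trans ((AEEqFun.coeFn_finsetSum _ _).trans (ae_of_all _ fun x => ?_))
    simp
  have hall : ∀ᵐ x, ∀ j, x ∉ tsupport f → S j (hf.toLp f) x = ∫ y, K j x y * f y :=
    ae_all_iff.2 fun j => hS j f hf hfc
  filter_upwards [hsum, hall, hg.coeFn_toLp] with x h1 h2 h3
  rw [h3, h1, RCLike.inner_apply, mul_comm, integral_const_mul]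
  by_cases hx : x ∈ tsupport f
  · have : g x = 0 := by
      by_contra h
      exact disjoint_left.1 hd hx (subset_tsupport g h)
    simp [this]
  · congr 1
    simp only [kernelSum, Finset.sum_mul]
    rw [integral_finsetSum _ fun j _ => integrable_kernel_section
      (fun z hz => continuousAt_kernel hK j hz) hfi hfc hx]
    exact Finset.sum_congr rfl fun j _ => h2 j hx

lemma HasWeakKernel.adjoint {T : LpRn n 2 →L[ℂ] LpRn n 2} {k : Rn n × Rn n → ℂ}
    (h : HasWeakKernel T k) :
    HasWeakKernel (ContinuousLinearMap.adjoint T) fun z => conj (k z.swap) := by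
  intro f g hf hg hfc hgc hd
  rw [ContinuousLinearMap.adjoint_inner_right, ← inner_conj_symm,
    h g f hg hf hgc hfc hd.symm, ← integral_conj]
  rw [Measure.volume_eq_prod, ← integral_prod_swap]
  congr 1 with z
  simp only [Prod.fst_swap, Prod.snd_swap, map_mul, Complex.conj_conj]
  ring

/-- The kernels of the adjoint operator. -/
def adjointKernel (K : Fin N → Rn n → Rn n → ℂ) (j : Fin N) (x y : Rn n) : ℂ := conj (K j y x)

/-- Swapping the variables and conjugating each change the sign of the phase, so the frequencies are
unchanged. Both operations are isometries, also for the maximum norm on the product. -/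
lemma JointGradientBound.adjoint {ξ : Fin N → Rn n} {K : Fin N → Rn n → Rn n → ℂ} {A : ℝ}
    (hK : JointGradientBound ξ K A) : JointGradientBound ξ (adjointKernel K) A := by
  have h1 : ∀ j, modulatedKernel (ξ j) (adjointKernel K j) =
      fun z => Complex.conjCLE (modulatedKernel (ξ j) (K j)
        (ContinuousLinearEquiv.prodComm ℝ (Rn n) (Rn n) z)) := by
    intro j
    ext z
    simp only [modulatedKernel, adjointKernel, Complex.conjCLE_apply, map_mul, ← Complex.exp_conj,
      Complex.conj_I, Complex.conj_ofReal, ContinuousLinearEquiv.prodComm_apply, Prod.fst_swap,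
      Prod.snd_swap]
    rw [← neg_sub z.1 z.2, inner_neg_right]
    push_cast
    ring_nf
  intro x y hxy
  have hd := fun j => ((hK y x hxy.symm).1 j).hasFDerivAt
  have hd' : ∀ j, HasFDerivAt (modulatedKernel (ξ j) (adjointKernel K j))
      ((Complex.conjCLE : ℂ →L[ℝ] ℂ).comp ((fderiv ℝ (modulatedKernel (ξ j) (K j)) (y, x)).comp
        (ContinuousLinearEquiv.prodComm ℝ (Rn n) (Rn n) : Rn n × Rn n →L[ℝ] Rn n × Rn n))) (x, y) := by
    intro j
    rw [h1]
    refine (Complex.conjCLE : ℂ →L[ℝ] ℂ).hasFDerivAt.comp (x, y) ?_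
    refine HasFDerivAt.comp (x, y) (f := ContinuousLinearEquiv.prodComm ℝ (Rn n) (Rn n))
      (hd j) ?_
    exact (ContinuousLinearEquiv.prodComm ℝ (Rn n) (Rn n) : Rn n × Rn n →L[ℝ] Rn n × Rn n).hasFDerivAt
  refine ⟨fun j => (hd' j).differentiableAt, ?_⟩
  rw [norm_sub_rev]
  refine le_trans (Finset.sum_le_sum fun j _ => ?_) (hK y x hxy.symm).2
  rw [(hd' j).fderiv]
  refine ContinuousLinearMap.opNorm_le_bound _ (norm_nonneg _) fun z => ?_
  simp only [ContinuousLinearMap.comp_apply, ContinuousLinearEquiv.coe_coe, Complex.conjCLE_apply,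
    ContinuousLinearEquiv.prodComm_apply, RCLike.norm_conj]
  refine (ContinuousLinearMap.le_opNorm _ _).trans ?_
  gcongr
  rw [Prod.norm_def, Prod.norm_def, max_comm]
  rfl

/-- The mean value inequality is applied once, to Σ θ_j M_j(x, ·) with phases θ_j that turn its
increment into the sum of absolute values. The hypothesis on the sum of the gradients then costs no
factor N. The factor 2 ^ (n + 1) comes from |x - z| ≥ |x - c| / 2 on the ball. -/
lemma sum_norm_modulatedKernel_sub_le {ξ : Fin N → Rn n} {K : Fin N → Rn n → Rn n → ℂ} {A : ℝ}
    (hA : 0 ≤ A) (hK : JointGradientBound ξ K A) {c x y : Rn n} {r : ℝ} (hr : 0 < r)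
    (hx : 2 * r ≤ ‖x - c‖) (hy : ‖y - c‖ ≤ r) :
    ∑ j, ‖modulatedKernel (ξ j) (K j) (x, y) - modulatedKernel (ξ j) (K j) (x, c)‖ ≤
      A * 2 ^ (n + 1) * (r / ‖x - c‖ ^ (n + 1)) := by
  set M := fun j => modulatedKernel (ξ j) (K j) with hM
  have hpos : 0 < ‖x - c‖ := by linarith
  have hθ : ∀ d : ℂ, ∃ θ : ℂ, ‖θ‖ ≤ 1 ∧ θ * d = ‖d‖ := by
    intro d
    refine ⟨conj d / ‖d‖, ?_, ?_⟩
    · rw [norm_div, RCLike.norm_conj, Complex.norm_real, norm_norm]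
      exact div_self_le_one _
    · rw [div_mul_eq_mul_div, mul_comm, Complex.mul_conj, Complex.normSq_eq_norm_sq]
      by_cases h : d = 0
      · simp [h]
      · have : (‖d‖ : ℂ) ≠ 0 := by simpa using h
        push_cast
        field_simp
  choose θ hθ1 hθ2 using fun j => hθ (M j (x, y) - M j (x, c))
  have hne : ∀ z ∈ closedBall c r, x ≠ z ∧ ‖x - c‖ / 2 ≤ ‖x - z‖ := by
    intro z hz
    rw [mem_closedBall, dist_eq_norm] at hz
    have h1 : ‖x - c‖ ≤ ‖x - z‖ + ‖z - c‖ := norm_sub_le_norm_sub_add_norm_sub _ _ _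
    refine ⟨?_, by linarith⟩
    rintro rfl
    rw [sub_self, norm_zero] at h1
    linarith
  have hderiv : ∀ z ∈ closedBall c r, HasFDerivWithinAt (fun z => ∑ j, θ j * M j (x, z))
      (∑ j, θ j • (fderiv ℝ (M j) (x, z)).comp (ContinuousLinearMap.inr ℝ (Rn n) (Rn n)))
      (closedBall c r) z := by
    intro z hz
    refine HasFDerivAt.hasFDerivWithinAt ?_
    refine HasFDerivAt.fun_sum fun j _ => ?_
    refine HasFDerivAt.const_mul ?_ (θ j)
    exact HasFDerivAt.comp z (f := fun z => (x, z)) ((hK x z (hne z hz).1).1 j).hasFDerivAt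
      (hasFDerivAt_prodMk_right x z)
  have hbound : ∀ z ∈ closedBall c r,
      ‖∑ j, θ j • (fderiv ℝ (M j) (x, z)).comp (ContinuousLinearMap.inr ℝ (Rn n) (Rn n))‖ ≤
        A * 2 ^ (n + 1) / ‖x - c‖ ^ (n + 1) := by
    intro z hz
    calc _ ≤ ∑ j, ‖fderiv ℝ (M j) (x, z)‖ := by
          refine (norm_sum_le _ _).trans (Finset.sum_le_sum fun j _ => ?_)
          rw [norm_smul]
          refine (mul_le_of_le_one_left (norm_nonneg _) (hθ1 j)).trans ?_
          refine (ContinuousLinearMap.opNorm_comp_le _ _).trans ?_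
          refine mul_le_of_le_one_right (norm_nonneg _) ?_
          exact ContinuousLinearMap.opNorm_le_bound _ zero_le_one fun w => by simp [Prod.norm_def]
      _ ≤ A / ‖x - z‖ ^ (n + 1) := (hK x z (hne z hz).1).2
      _ ≤ A / (‖x - c‖ / 2) ^ (n + 1) := by
          gcongr
          exact (hne z hz).2
      _ = _ := by
          rw [div_pow]
          field_simp
  have hmv := (convex_closedBall c r).norm_image_sub_le_of_norm_hasFDerivWithin_le hderiv hbound
    (mem_closedBall_self hr.le) (by rwa [mem_closedBall, dist_eq_norm])
  have heq : (∑ j, θ j * M j (x, y)) - ∑ j, θ j * M j (x, c) =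
      ((∑ j, ‖M j (x, y) - M j (x, c)‖ : ℝ) : ℂ) := by
    rw [← Finset.sum_sub_distrib, Complex.ofReal_sum]
    refine Finset.sum_congr rfl fun j _ => ?_
    rw [← hθ2 j]
    ring
  rw [heq, Complex.norm_real, Real.norm_of_nonneg (Finset.sum_nonneg fun _ _ => norm_nonneg _)]
    at hmv
  refine hmv.trans ?_
  calc _ ≤ A * 2 ^ (n + 1) / ‖x - c‖ ^ (n + 1) * r := by gcongr
    _ = _ := by ring

/-- Decay of the potential of a function with vanishing moments. -/
lemma norm_integral_kernelSum_le {ξ : Fin N → Rn n} {K : Fin N → Rn n → Rn n → ℂ} {A : ℝ}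
    (hA : 0 ≤ A) (hK : JointGradientBound ξ K A) {b : Rn n → ℂ} (hb : Integrable b)
    {c x : Rn n} {r : ℝ} (hr : 0 < r) (hbs : ∀ y ∉ ball c r, b y = 0)
    (hmom : ∀ j, ∫ y, conj (expChar (ξ j) y) * b y = 0) (hx : 2 * r ≤ ‖x - c‖) :
    ‖∫ y, kernelSum K (x, y) * b y‖ ≤
      A * 2 ^ (n + 1) * (r / ‖x - c‖ ^ (n + 1)) * ∫ y, ‖b y‖ := by
  have hts : tsupport b ⊆ closedBall c r := by
    refine closure_minimal (fun y hy => ?_) isClosed_closedBall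
    by_contra h
    exact hy (hbs y fun h' => h (ball_subset_closedBall h'))
  have hbc : HasCompactSupport b := (isCompact_closedBall c r).of_isClosed_subset
    (isClosed_tsupport b) hts
  have hxb : x ∉ tsupport b := fun h => by
    have := hts h
    rw [mem_closedBall, dist_eq_norm] at this
    linarith
  have h1 := integrable_kernel_section (fun z hz => continuousAt_kernelSum hK hz) hb hbc hxb
  have h2 : ∀ j, Integrable fun y => expChar (ξ j) x * modulatedKernel (ξ j) (K j) (x, c) *
      (conj (expChar (ξ j) y) * b y) := fun j => by
    refine Integrable.const_mul ?_ _
    refine hb.congr' ?_ (ae_of_all _ fun y => ?_)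
    · exact (Complex.continuous_conj.comp (continuous_expChar (ξ j))).aestronglyMeasurable.mul hb.1
    · simp
  -- The subtracted terms integrate to zero by the moment conditions; they freeze the second
  -- variable of each modulated kernel at c while keeping the phase in y.
  have h3 : ∫ y, kernelSum K (x, y) * b y = ∫ y, (kernelSum K (x, y) * b y -
      ∑ j, expChar (ξ j) x * modulatedKernel (ξ j) (K j) (x, c) *
        (conj (expChar (ξ j) y) * b y)) := by
    rw [integral_sub h1 (integrable_finsetSum _ fun j _ => h2 j),
      integral_finsetSum _ fun j _ => h2 j]
    simp only [integral_const_mul, hmom, mul_zero, Finset.sum_const_zero, sub_zero]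
  rw [h3, ← integral_const_mul]
  refine norm_integral_le_of_norm_le (hb.norm.const_mul _) (ae_of_all _ fun y => ?_)
  by_cases hy : y ∈ ball c r
  · have h4 : kernelSum K (x, y) * b y - ∑ j, expChar (ξ j) x *
        modulatedKernel (ξ j) (K j) (x, c) * (conj (expChar (ξ j) y) * b y) =
        (∑ j, expChar (ξ j) (x - y) * (modulatedKernel (ξ j) (K j) (x, y) -
          modulatedKernel (ξ j) (K j) (x, c))) * b y := by
      rw [kernelSum, Finset.sum_mul, ← Finset.sum_sub_distrib, Finset.sum_mul]
      refine Finset.sum_congr rfl fun j _ => ?_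
      simp only
      rw [eq_expChar_mul_modulatedKernel (ξ j) (K j) x y, expChar_sub]
      ring
    rw [h4, norm_mul]
    refine mul_le_mul_of_nonneg_right ?_ (norm_nonneg _)
    refine (norm_sum_le _ _).trans (le_trans (le_of_eq ?_)
      (sum_norm_modulatedKernel_sub_le hA hK hr hx (y := y) ?_))
    · simp
    · rw [mem_ball, dist_eq_norm] at hy
      exact hy.le
  · simp [hbs y hy]

end Kernels

/-! ### Integrability of the image of a bad function away from its support. -/

section BadPart

variable {n N : ℕ}

/-- Scale invariance: for |x - c| ≥ 2r the integrand is at most a constant times r^(-n) (1 + |x -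
c|/r)^(-n-1), a rescaled integrable function. -/
lemma exists_tail_bound (n : ℕ) : ∃ D : ℝ, 0 ≤ D ∧ ∀ (c : Rn n) (r : ℝ), 0 < r →
    ∫⁻ x in {x | 2 * r ≤ ‖x - c‖}, ENNReal.ofReal (r / ‖x - c‖ ^ (n + 1)) ≤ ENNReal.ofReal D := by
  let φ : Rn n → ℝ := fun x => (1 + ‖x‖) ^ (-((n : ℝ) + 1))
  have hφ : Integrable φ := integrable_one_add_norm (by simp)
  have hφ0 : ∀ x, 0 ≤ φ x := fun x => by positivity
  have hφ' : ∀ x, φ x = 1 / (1 + ‖x‖) ^ (n + 1) := fun x => by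
    simp only [φ]
    rw [Real.rpow_neg (by positivity), one_div]
    norm_cast
  refine ⟨2 ^ (n + 1) * ∫ x, φ x, by positivity, fun c r hr => ?_⟩
  have hint : Integrable fun x => φ (r⁻¹ • (x - c)) :=
    (hφ.comp_smul (inv_ne_zero hr.ne')).comp_sub_right c
  have hval : ∫ x, φ (r⁻¹ • (x - c)) = r ^ n * ∫ x, φ x := by
    rw [integral_sub_right_eq_self (fun x => φ (r⁻¹ • x)) c, Measure.integral_comp_inv_smul,
      finrank_euclideanSpace, Fintype.card_fin, abs_of_pos (by positivity), smul_eq_mul]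
  calc _ ≤ ∫⁻ x in {x | 2 * r ≤ ‖x - c‖},
        ENNReal.ofReal (2 ^ (n + 1) * (r ^ n)⁻¹ * φ (r⁻¹ • (x - c))) := by
        refine setLIntegral_mono' (measurableSet_le measurable_const (by fun_prop)) fun x hx => ?_
        refine ENNReal.ofReal_le_ofReal ?_
        have hx : 2 * r ≤ ‖x - c‖ := hx
        rw [hφ', norm_smul, norm_inv, Real.norm_of_nonneg hr.le]
        set t := ‖x - c‖
        have ht : 0 < t := by linarith
        have h1 : 1 + r⁻¹ * t ≤ 2 * t / r := by
          rw [le_div_iff₀ hr, add_mul, mul_right_comm, inv_mul_cancel₀ hr.ne']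
          linarith
        calc r / t ^ (n + 1) = 2 ^ (n + 1) * (r ^ n)⁻¹ * (1 / (2 * t / r) ^ (n + 1)) := by
              rw [div_pow, mul_pow]
              field_simp
              ring
          _ ≤ _ := by gcongr
    _ ≤ ∫⁻ x, ENNReal.ofReal (2 ^ (n + 1) * (r ^ n)⁻¹ * φ (r⁻¹ • (x - c))) :=
        lintegral_mono' Measure.restrict_le_self le_rfl
    _ = ENNReal.ofReal (∫ x, 2 ^ (n + 1) * (r ^ n)⁻¹ * φ (r⁻¹ • (x - c))) :=
        (ofReal_integral_eq_lintegral_ofReal (hint.const_mul _)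
          (ae_of_all _ fun x => mul_nonneg (by positivity) (hφ0 _))).symm
    _ = _ := by
        rw [integral_const_mul, hval]
        congr 1
        field_simp

/-- Continuity from below of the measure with density f, which requires no measurability of f. -/
lemma setLIntegral_le_of_forall_closedBall {f : Rn n → ℝ≥0∞} {F : Set (Rn n)}
    (hF : MeasurableSet F) {C : ℝ≥0∞}
    (h : ∀ R : ℝ, ∫⁻ x in F ∩ closedBall 0 R, f x ≤ C) : ∫⁻ x in F, f x ≤ C := by
  have hmeas : ∀ m : ℕ, MeasurableSet (F ∩ closedBall (0 : Rn n) m) := fun m =>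
    hF.inter measurableSet_closedBall
  have hU : F = ⋃ m : ℕ, F ∩ closedBall 0 m := by
    rw [← inter_iUnion, iUnion_closedBall_nat, inter_univ]
  rw [← withDensity_apply f hF]
  rw [hU, Monotone.measure_iUnion]
  · refine iSup_le fun m => ?_
    rw [withDensity_apply f (hmeas m)]
    exact h m
  · intro m m' hm
    exact inter_subset_inter_right _ (closedBall_subset_closedBall (by exact_mod_cast hm))

/-- The image of a function with vanishing moments is integrable away from the support. -/
lemma exists_bad_part_bound (n : ℕ) : ∃ D : ℝ, 0 ≤ D ∧ ∀ (N : ℕ) (ξ : Fin N → Rn n)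
    (K : Fin N → Rn n → Rn n → ℂ) (A : ℝ) (T : LpRn n 2 →L[ℂ] LpRn n 2), 0 ≤ A →
    JointGradientBound ξ K A → HasWeakKernel T (kernelSum K) →
    ∀ (b : Rn n → ℂ) (hb : MemLp b 2 volume) (c : Rn n) (r : ℝ), 0 < r →
      (∀ y ∉ ball c r, b y = 0) → (∀ j, ∫ y, conj (expChar (ξ j) y) * b y = 0) →
      ∫⁻ x in {x | 2 * r ≤ ‖x - c‖}, ‖T (hb.toLp b) x‖ₑ ≤
        ENNReal.ofReal (D * A * ∫ y, ‖b y‖) := by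
  obtain ⟨D, hD, htail⟩ := exists_tail_bound n
  refine ⟨2 ^ (n + 1) * D, by positivity, ?_⟩
  intro N ξ K A T hA hK hT b hb c r hr hbs hmom
  have hclosed : IsClosed {x : Rn n | 2 * r ≤ ‖x - c‖} :=
    isClosed_le continuous_const (by fun_prop)
  refine setLIntegral_le_of_forall_closedBall hclosed.measurableSet fun R => ?_
  set F := {x : Rn n | 2 * r ≤ ‖x - c‖} with hF
  have hFR : IsCompact (F ∩ closedBall 0 R) := (isCompact_closedBall 0 R).inter_left hclosed
  have hFRm := hFR.measurableSet
  have : IsFiniteMeasure ((volume : Measure (Rn n)).restrict (F ∩ closedBall 0 R)) :=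
    isFiniteMeasure_restrict.2 hFR.measure_lt_top.ne
  set u : LpRn n 2 := T (hb.toLp b)
  have hu : Measurable (u : Rn n → ℂ) := (Lp.stronglyMeasurable u).measurable
  -- The kernel of T is only accessible through pairings with compactly supported functions, so the
  -- L¹ norm of u = Tb on the truncated region is written as the pairing with its phase. Where u
  -- vanishes, the quotient is 0.
  let g : Rn n → ℂ := (F ∩ closedBall 0 R).indicator fun x => u x / ‖u x‖
  have hgbound : ∀ x, ‖u x / (‖u x‖ : ℂ)‖ ≤ 1 := fun x => by
    rw [norm_div, Complex.norm_real, norm_norm]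
    exact div_self_le_one _
  have hg : MemLp g 2 volume := by
    refine (memLp_indicator_iff_restrict hFRm).2 (MemLp.of_bound ?_ 1 (ae_of_all _ hgbound))
    exact (hu.div (Complex.measurable_ofReal.comp hu.norm)).aestronglyMeasurable
  have hts : tsupport b ⊆ closedBall c r := by
    refine closure_minimal (fun y hy => ?_) isClosed_closedBall
    by_contra h
    exact hy (hbs y fun h' => h (ball_subset_closedBall h'))
  have hbc : HasCompactSupport b := (isCompact_closedBall c r).of_isClosed_subset
    (isClosed_tsupport b) hts
  have htg : tsupport g ⊆ F ∩ closedBall 0 R :=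
    closure_minimal support_indicator_subset hFR.isClosed
  have hgc : HasCompactSupport g := hFR.of_isClosed_subset (isClosed_tsupport g) htg
  have hd : Disjoint (tsupport b) (tsupport g) := by
    refine disjoint_left.2 fun x hx hx' => ?_
    have h1 := hts hx
    have h2 : 2 * r ≤ ‖x - c‖ := (htg hx').1
    rw [mem_closedBall, dist_eq_norm] at h1
    linarith
  have hbi := integrable_of_memLp_of_hasCompactSupport hb hbc
  have hgi := integrable_of_memLp_of_hasCompactSupport hg hgc
  have h1 := hT b g hb hg hbc hgc hd
  have h2 : inner ℂ (hg.toLp g) u = ((∫ x in F ∩ closedBall 0 R, ‖u x‖ : ℝ) : ℂ) := by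
    rw [L2.inner_def, ← integral_complex_ofReal, ← integral_indicator hFRm]
    refine integral_congr_ae ?_
    filter_upwards [hg.coeFn_toLp] with x hx
    rw [hx, RCLike.inner_apply]
    by_cases hxF : x ∈ F ∩ closedBall 0 R
    · simp only [g, indicator_of_mem hxF]
      rw [map_div₀, Complex.conj_ofReal, ← mul_div_assoc, Complex.mul_conj,
        Complex.normSq_eq_norm_sq]
      by_cases h : u x = 0
      · simp [h]
      · have : (‖u x‖ : ℂ) ≠ 0 := by simpa using h
        push_cast
        field_simp
    · simp [g, hxF]
  have hui : IntegrableOn (u : Rn n → ℂ) (F ∩ closedBall 0 R) :=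
    ((Lp.memLp u).restrict _).integrable (by norm_num)
  have h3 : ∫⁻ x in F ∩ closedBall 0 R, ‖u x‖ₑ = ‖inner ℂ (hg.toLp g) u‖ₑ := by
    rw [h2, ← ofReal_norm, Complex.norm_real,
      Real.norm_of_nonneg (integral_nonneg fun _ => norm_nonneg _)]
    exact (ofReal_integral_norm_eq_lintegral_enorm hui).symm
  have hint := integrable_kernel_prod (fun z hz => continuousAt_kernelSum hK hz) hbi hgi hbc hgc hd
  rw [h3, h1]
  rw [Measure.volume_eq_prod] at hint ⊢
  rw [integral_prod _ hint]
  refine (enorm_integral_le_lintegral_enorm _).trans ?_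
  have hbI : 0 ≤ ∫ y, ‖b y‖ := integral_nonneg fun _ => norm_nonneg _
  calc _ ≤ ∫⁻ x, F.indicator (fun x => ENNReal.ofReal (A * 2 ^ (n + 1) * ∫ y, ‖b y‖) *
          ENNReal.ofReal (r / ‖x - c‖ ^ (n + 1))) x := by
        refine lintegral_mono fun x => ?_
        by_cases hxF : x ∈ F ∩ closedBall 0 R
        · simp only
          rw [indicator_of_mem hxF.1, integral_const_mul, ← ENNReal.ofReal_mul (by positivity),
            ← ofReal_norm]
          refine ENNReal.ofReal_le_ofReal ?_
          rw [norm_mul, RCLike.norm_conj]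
          have h4 := norm_integral_kernelSum_le hA hK hbi hr hbs hmom hxF.1
          have h5 : ‖g x‖ ≤ 1 := by
            simp only [g, indicator_of_mem hxF]
            exact hgbound x
          refine (mul_le_of_le_one_left (norm_nonneg _) h5).trans (h4.trans (le_of_eq ?_))
          ring
        · have : g x = 0 := indicator_of_notMem hxF _
          simp [this]
    _ = ENNReal.ofReal (A * 2 ^ (n + 1) * ∫ y, ‖b y‖) *
          ∫⁻ x in F, ENNReal.ofReal (r / ‖x - c‖ ^ (n + 1)) := by
        rw [lintegral_indicator hclosed.measurableSet, lintegral_const_mul _ (by fun_prop)]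
    _ ≤ ENNReal.ofReal (A * 2 ^ (n + 1) * ∫ y, ‖b y‖) * ENNReal.ofReal D := by
        gcongr
        exact htail c r hr
    _ = _ := by
        rw [← ENNReal.ofReal_mul (by positivity)]
        congr 1
        ring

end BadPart

/-! ### The multi-frequency Calderón–Zygmund decomposition. -/

section Decomposition

variable {n N : ℕ}

/-- The Whitney radii are distances to the complement, and `infDist` to the empty set would be 0. -/
lemma compl_nonempty_of_measure_ne_top [Nontrivial (Rn n)] {Ω : Set (Rn n)}
    (h : volume Ω ≠ ∞) : Ωᶜ.Nonempty := by
  rw [nonempty_compl]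
  rintro rfl
  have : NoncompactSpace (Rn n) := NormedSpace.noncompactSpace ℝ (Rn n)
  exact h (measure_univ_of_isAddLeftInvariant volume)

lemma integrable_norm_sq {f : Rn n → ℂ} (hf : MemLp f 2 volume) :
    Integrable fun y => ‖f y‖ ^ 2 := hf.integrable_norm_pow (by norm_num)

/-- The multi-frequency Calderón–Zygmund decomposition, with finitely many bad functions and a
remainder that is small in `L²`. -/
lemma exists_multiFrequency_decomposition [Nontrivial (Rn n)] (hN : 0 < N) (ξ : Fin N → Rn n)
    {f : Rn n → ℂ} (hf : MemLp f 2 volume) (hf1 : Integrable f) {t ε : ℝ} (ht : 0 < t)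
    (hε : 0 < ε) :
    ∃ (Ω : Set (Rn n)) (F : Finset (Rn n)) (r : Rn n → ℝ) (G q : Rn n → ℂ)
      (b : Rn n → Rn n → ℂ), MeasurableSet Ω ∧
      volume Ω ≤ ENNReal.ofReal (5 ^ n * (Real.sqrt N * (∫ y, ‖f y‖) / t)) ∧
      MemLp G 2 volume ∧ MemLp q 2 volume ∧ (∀ x, MemLp (b x) 2 volume) ∧
      f = G + ∑ x ∈ F, b x + q ∧
      (∀ x ∈ F, 0 < r x ∧ ball x (2 * r x) ⊆ Ω) ∧
      (∀ x, ∀ y ∉ ball x (r x), b x y = 0) ∧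
      (∀ x j, ∫ y, conj (expChar (ξ j) y) * b x y = 0) ∧
      ∫ y, ‖q y‖ ^ 2 ≤ ε ∧
      ∫ y, ‖G y‖ ^ 2 ≤
        2 * (1 + 48 ^ n * 36 ^ n * 36 ^ n * 5 ^ n) * t ^ 2 * (Real.sqrt N * (∫ y, ‖f y‖) / t) ∧
      ∑ x ∈ F, ∫ y, ‖b x y‖ ≤
        3 * (36 ^ n * 36 ^ n) * t * (5 ^ n * (Real.sqrt N * (∫ y, ‖f y‖) / t)) := by
  have hN1 : (1 : ℝ) ≤ N := by exact_mod_cast hN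
  have hsq : 1 ≤ Real.sqrt N := Real.one_le_sqrt.2 hN1
  -- This level makes N s² = t², which absorbs the loss N of the projection.
  set s := t / Real.sqrt N with hs
  have hs0 : 0 < s := by positivity
  have hst : s ≤ t := div_le_self ht.le hsq
  have hNs : N * s ^ 2 = t ^ 2 := by
    rw [hs, div_pow, Real.sq_sqrt (by positivity)]
    field_simp
  set M := ∫ y, ‖f y‖ with hM
  have hM0 : 0 ≤ M := integral_nonneg fun _ => norm_nonneg _
  set W := Real.sqrt N * M / t with hW
  have hW0 : 0 ≤ W := by positivity
  have hsM : s * M ≤ t ^ 2 * W := by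
    rw [hW, hs]
    calc t / Real.sqrt N * M ≤ t * M := by gcongr
      _ ≤ t * (Real.sqrt N * M) := by gcongr; exact le_mul_of_one_le_left hM0 hsq
      _ = _ := by field_simp
  set Ω := maximalLevelSet f s with hΩdef
  have hΩ : IsOpen Ω := isOpen_maximalLevelSet f s
  have hΩvol : volume Ω ≤ ENNReal.ofReal (5 ^ n * W) := by
    refine (volume_maximalLevelSet_le hf1 hs0).trans (le_of_eq ?_)
    congr 1
    rw [hW, hs, ← hM]
    field_simp
  have hΩfin : volume Ω ≠ ∞ := (hΩvol.trans_lt ENNReal.ofReal_lt_top).ne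
  have hne := compl_nonempty_of_measure_ne_top hΩfin
  obtain ⟨u, huΩ, hdisj, hcov⟩ := exists_whitney_covering hΩ hne hΩfin
  set ρ : Rn n → ℝ := fun x => infDist x Ωᶜ / 30 with hρ
  let B : Rn n → Set (Rn n) := fun x => ball x (5 * ρ x)
  -- the measure `‖f‖² dx`, used to choose finitely many balls
  let ν : Measure (Rn n) := volume.withDensity fun y => ENNReal.ofReal (‖f y‖ ^ 2)
  have hf2 := integrable_norm_sq hf
  have : IsFiniteMeasure ν := isFiniteMeasure_withDensity_ofReal hf2.2
  obtain ⟨F, hFu, hFν⟩ := exists_finset_measure_diff_lt (ν := ν) hΩ (b := B)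
    (fun _ => isOpen_ball) hcov (ENNReal.ofReal_pos.2 hε).ne'
  obtain ⟨w, hwm, hw0, hw1, hwB, hwsum⟩ := exists_partition_weights F B
    fun _ => measurableSet_ball
  set E := ⋃ x ∈ F, B x with hE
  have hEm : MeasurableSet E := Finset.measurableSet_biUnion F fun _ _ => measurableSet_ball
  have hpos : ∀ x ∈ F, 0 < infDist x Ωᶜ := fun x hx =>
    (hΩ.isClosed_compl.notMem_iff_infDist_pos hne).1 (by simpa using huΩ (hFu hx))
  have hρpos : ∀ x ∈ F, 0 < ρ x := fun x hx => by
    have := hpos x hx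
    simp only [hρ]
    positivity
  have hballΩ : ∀ x, ball x (30 * ρ x) ⊆ Ω := fun x => by
    rw [show 30 * ρ x = infDist x Ωᶜ by simp only [hρ]; ring]
    exact disjoint_compl_right_iff_subset.1 disjoint_ball_infDist
  have hEΩ : E ⊆ Ω := iUnion₂_subset fun x hx =>
    (ball_subset_ball (by have := hρpos x hx; linarith)).trans (hballΩ x)
  let h : Rn n → Rn n → ℂ := fun x y => (w x y : ℂ) * f y
  have hhle : ∀ x y, ‖h x y‖ ≤ ‖f y‖ := fun x y => by
    rw [norm_mul, Complex.norm_real, Real.norm_of_nonneg (hw0 x y)]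
    exact mul_le_of_le_one_left (norm_nonneg _) (hw1 x y)
  have hhm : ∀ x, AEStronglyMeasurable (h x) volume := fun x =>
    (Complex.measurable_ofReal.comp (hwm x)).aestronglyMeasurable.mul hf.1
  have hh2 : ∀ x, MemLp (h x) 2 volume := fun x => hf.mono (hhm x) (ae_of_all _ (hhle x))
  have hh1 : ∀ x, Integrable (h x) := fun x => hf1.mono (hhm x) (ae_of_all _ (hhle x))
  have hhs : ∀ x, ∀ y ∉ B x, h x y = 0 := fun x y hy => by simp [h, hwB x y hy]
  choose φ hφ2 hφs hφmom hφnorm using fun x => exists_same_moments ξ (hh2 x) (hhs x)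
  set v : Rn n → ℝ := fun x => volume.real (ball (0 : Rn n) (ρ x)) with hv
  have hvsum : ∑ x ∈ F, v x ≤ 5 ^ n * W := by
    have h1 : ∑ x ∈ F, v x = volume.real (⋃ x ∈ F, ball x (ρ x)) := by
      rw [measureReal_biUnion_finset ?_ (fun _ _ => measurableSet_ball)
        (fun _ _ => measure_ball_lt_top.ne)]
      · exact Finset.sum_congr rfl fun x _ => (measureReal_ball_center x _).symm
      · intro a ha b hb hab
        refine (hdisj (hFu ha) (hFu hb) hab).mono ?_ ?_ <;> exact ball_subset_closedBall
    rw [h1]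
    refine (measureReal_mono (iUnion₂_subset fun x hx => ?_) hΩfin).trans
      (ENNReal.toReal_le_of_le_ofReal (by positivity) hΩvol)
    exact (ball_subset_ball (by have := hρpos x hx; linarith)).trans (hballΩ x)
  -- A nearest point z of the complement is at distance 30ρ, so the ball of radius 36ρ about z
  -- contains the support ball of radius 5ρ. As z is outside Ω, the mean of |f| over it is at most
  -- s.
  have hhint : ∀ x ∈ F, ∫ y, ‖h x y‖ ≤ s * (36 ^ n * v x) := by
    intro x hx
    have hx0 := hρpos x hx
    obtain ⟨z, hz, hxz⟩ := hΩ.isClosed_compl.exists_infDist_eq_dist hne x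
    have hxz' : dist x z = 30 * ρ x := by rw [← hxz]; simp only [hρ]; ring
    calc ∫ y, ‖h x y‖ ≤ ∫ y in ball z (36 * ρ x), ‖f y‖ := by
          rw [← integral_indicator measurableSet_ball]
          refine integral_mono (hh1 x).norm (hf1.norm.indicator measurableSet_ball) fun y => ?_
          by_cases hy : y ∈ B x
          · have : y ∈ ball z (36 * ρ x) := ball_subset_ball' (by rw [hxz']; linarith) hy
            rw [indicator_of_mem this]
            exact hhle x y
          · rw [hhs x y hy, norm_zero]
            exact indicator_nonneg (fun _ _ => norm_nonneg _) y
      _ ≤ s * volume.real (ball z (36 * ρ x)) :=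
          setIntegral_ball_le_of_notMem hz (mem_ball_self (by positivity))
      _ = _ := by rw [measureReal_ball_mul z (by norm_num)]
  have hvpos : ∀ x ∈ F, 0 < v x := fun x hx => measureReal_ball_pos 0 (hρpos x hx)
  have hφint : ∀ x ∈ F, ∫ y, ‖φ x y‖ ^ 2 ≤ t ^ 2 * (36 ^ n * 36 ^ n) * v x := by
    intro x hx
    have hvx := hvpos x hx
    have h1 := hφnorm x
    rw [measureReal_ball_mul 0 (by norm_num)] at h1
    have h0 : 0 ≤ ∫ y, ‖φ x y‖ ^ 2 := integral_nonneg fun _ => by positivity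
    have h2 : (∫ y, ‖φ x y‖ ^ 2) * v x ≤ (∫ y, ‖φ x y‖ ^ 2) * (5 ^ n * v x) := by
      gcongr
      exact le_mul_of_one_le_left hvx.le (one_le_pow₀ (by norm_num))
    have h3 : (N : ℝ) * (∫ y, ‖h x y‖) ^ 2 ≤ N * (s * (36 ^ n * v x)) ^ 2 := by
      have : 0 ≤ ∫ y, ‖h x y‖ := integral_nonneg fun _ => norm_nonneg _
      gcongr
      exact hhint x hx
    refine le_of_mul_le_mul_right (h2.trans (h1.trans (h3.trans (le_of_eq ?_)))) hvx
    rw [← hNs]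
    ring
  have hφs' : ∀ x, ∀ y ∉ ball x (15 * ρ x), φ x y = 0 := fun x y hy => by
    refine hφs x y ?_
    rwa [show 3 * (5 * ρ x) = 15 * ρ x by ring]
  have hφi : ∀ x, Integrable (φ x) := fun x => by
    refine (integrableOn_iff_integrable_of_support_subset (s := ball x (15 * ρ x)) ?_).1
      (((hφ2 x).restrict _).integrable (by norm_num))
    intro y hy
    by_contra h'
    exact hy (hφs' x y h')
  have hφ1 : ∀ x ∈ F, ∫ y, ‖φ x y‖ ≤ 2 * (36 ^ n * 36 ^ n) * t * v x := by
    intro x hx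
    have hvx := hvpos x hx
    have hi := integrable_norm_sq (hφ2 x)
    have hi' : Integrable ((ball x (15 * ρ x)).indicator fun _ : Rn n => t) :=
      (integrable_indicator_iff measurableSet_ball).2 (integrable_const t)
    -- The pointwise inequality a ≤ t + a²/t on the support passes from L² to L¹.
    calc ∫ y, ‖φ x y‖ ≤ ∫ y, ((ball x (15 * ρ x)).indicator (fun _ => t) y + t⁻¹ * ‖φ x y‖ ^ 2) := by
          refine integral_mono (hφi x).norm (hi'.add (hi.const_mul _)) fun y => ?_
          by_cases hy : y ∈ ball x (15 * ρ x)
          · simp only [indicator_of_mem hy]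
            rw [← sub_nonneg]
            have h1 : t + t⁻¹ * ‖φ x y‖ ^ 2 - ‖φ x y‖ =
                t⁻¹ * ((t - ‖φ x y‖ / 2) ^ 2 + 3 / 4 * ‖φ x y‖ ^ 2) := by
              field_simp
              ring
            rw [h1]
            positivity
          · simp [hφs' x y hy, hy]
      _ = t * (15 ^ n * v x) + t⁻¹ * ∫ y, ‖φ x y‖ ^ 2 := by
          rw [integral_add hi' (hi.const_mul _), integral_const_mul,
            integral_indicator measurableSet_ball, setIntegral_const,
            measureReal_ball_mul x (by norm_num), smul_eq_mul, mul_comm t]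
      _ ≤ t * ((36 ^ n * 36 ^ n) * v x) + t⁻¹ * (t ^ 2 * (36 ^ n * 36 ^ n) * v x) := by
          have h15 : (15 : ℝ) ^ n ≤ 36 ^ n * 36 ^ n := by
            rw [← mul_pow]
            gcongr
            norm_num
          gcongr
          exact hφint x hx
      _ = _ := by
          field_simp
          ring
  let b : Rn n → Rn n → ℂ := fun x => h x - φ x
  have hb2 : ∀ x, MemLp (b x) 2 volume := fun x => (hh2 x).sub (hφ2 x)
  let G : Rn n → ℂ := Ωᶜ.indicator f + ∑ x ∈ F, φ x
  let q : Rn n → ℂ := (Ω \ E).indicator f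
  have hG2 : MemLp G 2 volume := (hf.indicator hΩ.measurableSet.compl).add
    (memLp_finsetSum' F fun x _ => hφ2 x)
  -- Radius 15ρ contains both h and φ, and its double 30ρ is the distance to the complement, so the
  -- doubled ball stays in Ω. The part of f on Ω missed by the finitely many balls is q.
  refine ⟨Ω, F, fun x => 15 * ρ x, G, q, b, hΩ.measurableSet, hΩvol, hG2,
    hf.indicator (hΩ.measurableSet.diff hEm), hb2, ?_, fun x hx => ⟨?_, ?_⟩, fun x y hy => ?_,
    fun x j => hφmom x j, ?_, ?_, ?_⟩
  · ext y
    have h1 : ∑ x ∈ F, h x y = E.indicator f y := by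
      simp only [h]
      rw [← Finset.sum_mul, ← Complex.ofReal_sum, hwsum]
      by_cases hy : y ∈ E <;> simp [hy]
    have h2 : f y = Ωᶜ.indicator f y + E.indicator f y + (Ω \ E).indicator f y := by
      by_cases hy : y ∈ E
      · have := hEΩ hy
        simp [hy, this]
      · by_cases hy' : y ∈ Ω <;> simp [hy, hy']
    simp only [G, b, q, Pi.add_apply, Finset.sum_apply, Pi.sub_apply, Finset.sum_sub_distrib]
    rw [h1]
    conv_lhs => rw [h2]
    ring
  · have := hρpos x hx; positivity
  · refine (ball_subset_ball ?_).trans (hballΩ x)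
    linarith
  · have h1 : y ∉ B x := fun h' => by
      have : 0 < 5 * ρ x := pos_of_mem_ball h'
      exact hy (ball_subset_ball (by linarith) h')
    simp [b, hhs x y h1, hφs' x y hy]
  · have h1 : ENNReal.ofReal (∫ y, ‖q y‖ ^ 2) = ν (Ω \ E) := by
      rw [withDensity_apply _ (hΩ.measurableSet.diff hEm),
        ← ofReal_integral_eq_lintegral_ofReal hf2.integrableOn (ae_of_all _ fun _ => by positivity),
        ← integral_indicator (hΩ.measurableSet.diff hEm)]
      congr 2 with y
      by_cases hy : y ∈ Ω \ E
      · simp only [q, indicator_of_mem hy]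
      · simp only [q, indicator_of_notMem hy]
        simp
    rw [← h1] at hFν
    exact ((ENNReal.ofReal_lt_ofReal_iff hε).1 hFν).le
  · have hoverlap : ∀ y, ‖∑ x ∈ F, φ x y‖ ^ 2 ≤ 48 ^ n * ∑ x ∈ F, ‖φ x y‖ ^ 2 := by
      intro y
      classical
      have h1 : ∑ x ∈ F, φ x y = ∑ x ∈ F.filter fun x => y ∈ ball x (15 * ρ x), φ x y := by
        rw [Finset.sum_filter]
        refine Finset.sum_congr rfl fun x _ => ?_
        split_ifs with hy
        · rfl
        · exact hφs' x y hy
      have h2 := whitney_overlap_le hpos (hdisj.subset hFu) y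
      rw [h1]
      calc _ ≤ (∑ x ∈ F.filter fun x => y ∈ ball x (15 * ρ x), ‖φ x y‖) ^ 2 := by
            gcongr
            exact norm_sum_le _ _
        _ ≤ _ := sq_sum_le_card_mul_sum_sq
        _ ≤ _ := by
            gcongr
            exact Finset.filter_subset _ _
    have hi1 : Integrable fun y => 2 * (s * ‖f y‖) := (hf1.norm.const_mul s).const_mul 2
    have hi2 : Integrable fun y => 2 * (48 ^ n * ∑ x ∈ F, ‖φ x y‖ ^ 2) :=
      ((integrable_finsetSum F fun x _ => integrable_norm_sq (hφ2 x)).const_mul _).const_mul 2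
    calc ∫ y, ‖G y‖ ^ 2
        ≤ ∫ y, (2 * (s * ‖f y‖) + 2 * (48 ^ n * ∑ x ∈ F, ‖φ x y‖ ^ 2)) := by
          refine integral_mono_ae (integrable_norm_sq hG2) (hi1.add hi2) ?_
          filter_upwards [ae_norm_le_of_notMem_maximalLevelSet hf1 s] with y hy
          have h1 : ‖Ωᶜ.indicator f y‖ ^ 2 ≤ s * ‖f y‖ := by
            by_cases hyΩ : y ∈ Ω
            · have hyc : y ∉ Ωᶜ := not_not.2 hyΩ
              rw [indicator_of_notMem hyc, norm_zero, zero_pow two_ne_zero]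
              positivity
            · rw [indicator_of_mem hyΩ, sq]
              gcongr
              exact hy hyΩ
          have h2 : ‖G y‖ ^ 2 ≤ 2 * ‖Ωᶜ.indicator f y‖ ^ 2 + 2 * ‖∑ x ∈ F, φ x y‖ ^ 2 := by
            simp only [G, Pi.add_apply, Finset.sum_apply]
            have h3 := norm_add_le (Ωᶜ.indicator f y) (∑ x ∈ F, φ x y)
            have h4 := pow_le_pow_left₀ (norm_nonneg _) h3 2
            have h5 := add_sq_le (a := ‖Ωᶜ.indicator f y‖) (b := ‖∑ x ∈ F, φ x y‖)
            linarith
          have h3 := hoverlap y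
          linarith
      _ = 2 * (s * M) + 2 * (48 ^ n * ∑ x ∈ F, ∫ y, ‖φ x y‖ ^ 2) := by
          rw [integral_add hi1 hi2]
          simp only [integral_const_mul]
          rw [integral_finsetSum _ fun x _ => integrable_norm_sq (hφ2 x)]
      _ ≤ 2 * (t ^ 2 * W) + 2 * (48 ^ n * ∑ x ∈ F, t ^ 2 * (36 ^ n * 36 ^ n) * v x) := by
          gcongr with x hx
          exact hφint x hx
      _ ≤ 2 * (t ^ 2 * W) + 2 * (48 ^ n * (t ^ 2 * (36 ^ n * 36 ^ n) * (5 ^ n * W))) := by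
          rw [← Finset.mul_sum]
          gcongr
      _ = _ := by ring
  · calc ∑ x ∈ F, ∫ y, ‖b x y‖ ≤ ∑ x ∈ F, 3 * (36 ^ n * 36 ^ n) * t * v x := by
          refine Finset.sum_le_sum fun x hx => ?_
          have h1 : ∫ y, ‖b x y‖ ≤ (∫ y, ‖h x y‖) + ∫ y, ‖φ x y‖ := by
            rw [← integral_add (hh1 x).norm (hφi x).norm]
            exact integral_mono ((hh1 x).sub (hφi x)).norm ((hh1 x).norm.add (hφi x).norm)
              fun y => norm_sub_le _ _
          have h2 : s * (36 ^ n * v x) ≤ (36 ^ n * 36 ^ n) * t * v x := by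
            have h36 : (36 : ℝ) ^ n ≤ 36 ^ n * 36 ^ n :=
              le_mul_of_one_le_left (by positivity) (one_le_pow₀ (by norm_num))
            have hvx := hvpos x hx
            calc s * (36 ^ n * v x) ≤ t * ((36 ^ n * 36 ^ n) * v x) := by gcongr
              _ = _ := by ring
          have h3 := hhint x hx
          have h4 := hφ1 x hx
          linarith
      _ ≤ _ := by
          rw [← Finset.mul_sum]
          gcongr

end Decomposition

/-! ### The weak type inequality on L¹ ∩ L². -/

section WeakType

variable {n : ℕ}

lemma measure_lt_norm_le_of_lp_two (u : LpRn n 2) {t : ℝ} (ht : 0 < t) :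
    volume {x | t < ‖u x‖} ≤ ENNReal.ofReal (‖u‖ ^ 2 / t ^ 2) := by
  have h1 : ‖u‖ ^ 2 = ∫ x, ‖u x‖ ^ 2 := by
    conv_lhs => rw [← Lp.toLp_coeFn u (Lp.memLp u)]
    exact norm_toLp_sq_eq_integral (Lp.memLp u)
  have hi : Integrable fun x => ‖u x‖ ^ 2 := integrable_norm_sq (Lp.memLp u)
  have h2 : volume {x | t < ‖u x‖} ≤ volume {x | t ^ 2 ≤ ‖u x‖ ^ 2} := by
    refine measure_mono fun x (hx : t < ‖u x‖) => ?_
    exact pow_le_pow_left₀ ht.le hx.le 2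
  have h3 := mul_meas_ge_le_integral_of_nonneg (ae_of_all _ fun x => by positivity) hi (t ^ 2)
  rw [← h1] at h3
  have hfin : volume {x | t ^ 2 ≤ ‖u x‖ ^ 2} ≠ ∞ :=
    (hi.measure_ge_lt_top (by positivity)).ne
  refine h2.trans ?_
  rw [← ofReal_measureReal hfin]
  refine ENNReal.ofReal_le_ofReal ?_
  rw [le_div_iff₀ (by positivity), mul_comm]
  exact h3

/-- The weak type `(1, 1)` inequality on `L¹ ∩ L²`. -/
theorem exists_weakType_bound (n : ℕ) [Nontrivial (Rn n)] {A B : ℝ} (hA : 0 ≤ A) :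
    ∃ C : ℝ, 0 ≤ C ∧ ∀ (N : ℕ) (ξ : Fin N → Rn n) (K : Fin N → Rn n → Rn n → ℂ)
      (T : LpRn n 2 →L[ℂ] LpRn n 2), 0 < N → ‖T‖ ≤ B → JointGradientBound ξ K A →
      HasWeakKernel T (kernelSum K) →
      ∀ (f : Rn n → ℂ) (hf : MemLp f 2 volume), Integrable f → ∀ t : ℝ, 0 < t →
        volume {x | t < ‖T (hf.toLp f) x‖} ≤
          ENNReal.ofReal (C * (Real.sqrt N * (∫ y, ‖f y‖) / t)) := by
  obtain ⟨D, hD, hbad⟩ := exists_bad_part_bound n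
  set c₁ : ℝ := 2 * (1 + 48 ^ n * 36 ^ n * 36 ^ n * 5 ^ n) with hc₁
  set c₂ : ℝ := 3 * (36 ^ n * 36 ^ n) * 5 ^ n with hc₂
  refine ⟨9 * B ^ 2 * c₁ + 5 ^ n + 3 * D * A * c₂, by positivity, ?_⟩
  intro N ξ K T hN hTB hK hT f hf hf1 t ht
  have hB : 0 ≤ B := (norm_nonneg T).trans hTB
  have hM0 : 0 ≤ ∫ y, ‖f y‖ := integral_nonneg fun _ => norm_nonneg _
  -- The arbitrary ε pays for the remainder q, which allows finitely many bad functions and avoids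
  -- exchanging T with an infinite sum. The factor 9 comes from the threshold t/3, and B² + 1 keeps
  -- the denominator positive when B = 0.
  refine ENNReal.le_of_forall_pos_le_add fun ε hε _ => ?_
  obtain ⟨Ω, F, r, G, q, b, hΩ, hΩvol, hG, hq, hb, hfeq, hr, hbs, hbm, hqε, hGint, hbint⟩ :=
    exists_multiFrequency_decomposition hN ξ hf hf1 (t := t)
      (ε := (ε : ℝ) * t ^ 2 / (9 * (B ^ 2 + 1))) ht (by positivity)
  set W := Real.sqrt N * (∫ y, ‖f y‖) / t with hW
  have hW0 : 0 ≤ W := by positivity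
  have hBp : MemLp (∑ x ∈ F, b x) 2 volume := memLp_finsetSum' F fun x _ => hb x
  have hTf : T (hf.toLp f) = T (hG.toLp G) + ∑ x ∈ F, T ((hb x).toLp (b x)) + T (hq.toLp q) := by
    rw [← map_sum, ← map_add, ← map_add]
    congr 1
    have h1 : ∑ x ∈ F, (hb x).toLp (b x) = hBp.toLp (∑ x ∈ F, b x) := by
      ext1
      refine (Lp.coeFn_finsetSum _ _).trans (EventuallyEq.trans ?_ hBp.coeFn_toLp.symm)
      exact eventuallyEq_sum fun x _ => (hb x).coeFn_toLp
    rw [h1, ← MemLp.toLp_add hG hBp, ← MemLp.toLp_add (hG.add hBp) hq]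
    exact MemLp.toLp_congr _ _ (by rw [hfeq])
  set g' := T (hG.toLp G)
  set b' := fun x => T ((hb x).toLp (b x)) with hb'
  set q' := T (hq.toLp q)
  have hL2 : ∀ (w : Rn n → ℂ) (hw : MemLp w 2 volume) (M : ℝ), ∫ y, ‖w y‖ ^ 2 ≤ M →
      volume {x | t / 3 < ‖T (hw.toLp w) x‖} ≤ ENNReal.ofReal (9 * B ^ 2 * M / t ^ 2) := by
    intro w hw M hM
    refine (measure_lt_norm_le_of_lp_two _ (by positivity)).trans (ENNReal.ofReal_le_ofReal ?_)
    have h1 : ‖T (hw.toLp w)‖ ≤ B * ‖hw.toLp w‖ :=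
      (T.le_opNorm _).trans (by gcongr)
    have h2 : ‖T (hw.toLp w)‖ ^ 2 ≤ B ^ 2 * M := by
      refine (pow_le_pow_left₀ (norm_nonneg _) h1 2).trans ?_
      rw [mul_pow, norm_toLp_sq_eq_integral hw]
      gcongr
    calc _ ≤ B ^ 2 * M / (t / 3) ^ 2 := by gcongr
      _ = _ := by
        field_simp
        ring
  have hsub : ∀ᵐ x, x ∈ {x | t < ‖T (hf.toLp f) x‖} → x ∈ {x | t / 3 < ‖g' x‖} ∪
      (Ω ∪ {x | x ∉ Ω ∧ t / 3 ≤ ‖∑ i ∈ F, b' i x‖}) ∪ {x | t / 3 < ‖q' x‖} := by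
    filter_upwards [Lp.coeFn_add (g' + ∑ x ∈ F, b' x) q', Lp.coeFn_add g' (∑ x ∈ F, b' x),
      Lp.coeFn_finsetSum F b'] with x h1 h2 h3 hx
    by_contra h
    simp only [mem_union, mem_ofPred_eq, not_or, not_and, not_lt, not_le] at h
    obtain ⟨⟨h4, h5, h6⟩, h7⟩ := h
    have h8 := h6 h5
    have hx' : t < ‖T (hf.toLp f) x‖ := hx
    rw [hTf, h1, Pi.add_apply, h2, Pi.add_apply, h3, Finset.sum_apply] at hx'
    have h9 := norm_add₃_le (a := g' x) (b := ∑ i ∈ F, b' i x) (c := q' x)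
    linarith
  have hbadset : volume {x | x ∉ Ω ∧ t / 3 ≤ ‖∑ i ∈ F, b' i x‖} ≤
      ENNReal.ofReal (3 * D * A * c₂ * W) := by
    have hm : ∀ x, Measurable fun y => b' x y := fun x => (Lp.stronglyMeasurable (b' x)).measurable
    have h1 : ∫⁻ y in Ωᶜ, ‖∑ i ∈ F, b' i y‖ₑ ≤ ENNReal.ofReal (D * A * (c₂ * t * W)) := by
      calc _ ≤ ∫⁻ y in Ωᶜ, ∑ i ∈ F, ‖b' i y‖ₑ := by
            refine lintegral_mono fun y => ?_
            exact enorm_sum_le _ _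
        _ = ∑ i ∈ F, ∫⁻ y in Ωᶜ, ‖b' i y‖ₑ :=
            lintegral_finsetSum _ fun i _ => (hm i).enorm
        _ ≤ ∑ i ∈ F, ENNReal.ofReal (D * A * ∫ y, ‖b i y‖) := by
            refine Finset.sum_le_sum fun i hi => ?_
            refine le_trans ?_ (hbad N ξ K A T hA hK hT (b i) (hb i) i (r i) (hr i hi).1
              (hbs i) (hbm i))
            refine lintegral_mono_set fun y hy => ?_
            by_contra h
            refine hy ((hr i hi).2 ?_)
            rw [mem_ball, dist_eq_norm]
            exact not_le.1 h
        _ = ENNReal.ofReal (D * A * ∑ i ∈ F, ∫ y, ‖b i y‖) := by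
            rw [Finset.mul_sum, ENNReal.ofReal_sum_of_nonneg]
            exact fun i _ => mul_nonneg (by positivity) (integral_nonneg fun _ => norm_nonneg _)
        _ ≤ _ := by
            refine ENNReal.ofReal_le_ofReal ?_
            gcongr
            refine hbint.trans (le_of_eq ?_)
            rw [hc₂]
            ring
    have h2 : {x | x ∉ Ω ∧ t / 3 ≤ ‖∑ i ∈ F, b' i x‖} ⊆
        {x | ENNReal.ofReal (t / 3) ≤ ‖∑ i ∈ F, b' i x‖ₑ} ∩ Ωᶜ := by
      rintro x ⟨hx1, hx2⟩
      refine ⟨?_, hx1⟩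
      rw [mem_ofPred_eq, ← ofReal_norm]
      exact ENNReal.ofReal_le_ofReal hx2
    have h3 : Measurable fun y => ‖∑ i ∈ F, b' i y‖ₑ :=
      (Finset.measurable_fun_sum F fun i _ => hm i).enorm
    have ht3 : 0 < t / 3 := by positivity
    calc _ ≤ volume.restrict Ωᶜ {x | ENNReal.ofReal (t / 3) ≤ ‖∑ i ∈ F, b' i x‖ₑ} := by
          rw [Measure.restrict_apply (measurableSet_le measurable_const h3)]
          exact measure_mono h2
      _ ≤ (∫⁻ y in Ωᶜ, ‖∑ i ∈ F, b' i y‖ₑ) / ENNReal.ofReal (t / 3) :=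
          meas_ge_le_lintegral_div h3.aemeasurable (ENNReal.ofReal_pos.2 ht3).ne'
            ENNReal.ofReal_ne_top
      _ ≤ ENNReal.ofReal (D * A * (c₂ * t * W)) / ENNReal.ofReal (t / 3) := by gcongr
      _ = _ := by
          rw [← ENNReal.ofReal_div_of_pos ht3]
          congr 1
          field_simp
  have hgood := hL2 G hG _ hGint
  have hrest := hL2 q hq _ hqε
  calc volume {x | t < ‖T (hf.toLp f) x‖}
      ≤ volume ({x | t / 3 < ‖g' x‖} ∪ (Ω ∪ {x | x ∉ Ω ∧ t / 3 ≤ ‖∑ i ∈ F, b' i x‖}) ∪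
        {x | t / 3 < ‖q' x‖}) := measure_mono_ae hsub
    _ ≤ volume {x | t / 3 < ‖g' x‖} + (volume Ω +
        volume {x | x ∉ Ω ∧ t / 3 ≤ ‖∑ i ∈ F, b' i x‖}) + volume {x | t / 3 < ‖q' x‖} := by
        refine (measure_union_le _ _).trans ?_
        gcongr
        refine (measure_union_le _ _).trans ?_
        gcongr
        exact measure_union_le _ _
    _ ≤ ENNReal.ofReal (9 * B ^ 2 * (c₁ * t ^ 2 * W) / t ^ 2) +
        (ENNReal.ofReal (5 ^ n * W) + ENNReal.ofReal (3 * D * A * c₂ * W)) +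
        ENNReal.ofReal ε := by
        gcongr
        refine hrest.trans (ENNReal.ofReal_le_ofReal ?_)
        have h1 : 9 * B ^ 2 * ((ε : ℝ) * t ^ 2 / (9 * (B ^ 2 + 1))) / t ^ 2 =
            ε * (B ^ 2 / (B ^ 2 + 1)) := by
          field_simp
        rw [h1]
        refine mul_le_of_le_one_right ε.2 ?_
        rw [div_le_one (by positivity)]
        linarith
    _ = _ := by
        rw [ENNReal.ofReal_coe_nnreal, ← ENNReal.ofReal_add (by positivity) (by positivity),
          ← ENNReal.ofReal_add (by positivity) (by positivity)]
        congr 2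
        field_simp
        ring

end WeakType

/-! ### Marcinkiewicz interpolation between weak L¹ and L². -/

section Interpolation

variable {n : ℕ}

lemma lintegral_Ioo_rpow {r c : ℝ} (hr : -1 < r) (hc : 0 ≤ c) :
    ∫⁻ t in Ioo 0 c, ENNReal.ofReal (t ^ r) = ENNReal.ofReal (c ^ (r + 1) / (r + 1)) := by
  have h1 : IntegrableOn (fun t : ℝ => t ^ r) (Ioc 0 c) :=
    (intervalIntegrable_iff_integrableOn_Ioc_of_le hc).1
      (intervalIntegral.intervalIntegrable_rpow' hr)
  rw [restrict_Ioo_eq_restrict_Ioc, ← ofReal_integral_eq_lintegral_ofReal h1,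
    ← intervalIntegral.integral_of_le hc, integral_rpow (Or.inl hr),
    Real.zero_rpow (by linarith), sub_zero]
  filter_upwards [ae_restrict_mem measurableSet_Ioc] with t ht
  exact Real.rpow_nonneg ht.1.le _

lemma lintegral_Ioi_rpow {r c : ℝ} (hr : r < -1) (hc : 0 < c) :
    ∫⁻ t in Ioi c, ENNReal.ofReal (t ^ r) = ENNReal.ofReal (-c ^ (r + 1) / (r + 1)) := by
  rw [← ofReal_integral_eq_lintegral_ofReal (integrableOn_Ioi_rpow_of_lt hr hc),
    integral_Ioi_rpow_of_lt hr hc]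
  filter_upwards [ae_restrict_mem measurableSet_Ioi] with t ht
  exact Real.rpow_nonneg (hc.trans ht).le _

/-- Splitting a function at the height `s` in the weak type inequality. -/
lemma measure_lt_norm_le_of_split {T : LpRn n 2 →L[ℂ] LpRn n 2} {B C : ℝ} (hTB : ‖T‖ ≤ B)
    (hC : 0 ≤ C)
    (hweak : ∀ (f : Rn n → ℂ) (hf : MemLp f 2 volume), Integrable f → ∀ t : ℝ, 0 < t →
      volume {x | t < ‖T (hf.toLp f) x‖} ≤ ENNReal.ofReal (C * (∫ y, ‖f y‖) / t))
    (f : LpRn n 2) {s t : ℝ} (hs : 0 < s) (ht : 0 < t) :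
    volume {x | t < ‖T f x‖} ≤
      ENNReal.ofReal (2 * C / t) * (∫⁻ x, if s < ‖f x‖ then ENNReal.ofReal ‖f x‖ else 0) +
      ENNReal.ofReal (4 * B ^ 2 / t ^ 2) *
        ∫⁻ x, if s < ‖f x‖ then 0 else ENNReal.ofReal (‖f x‖ ^ 2) := by
  have hfm : Measurable (f : Rn n → ℂ) := (Lp.stronglyMeasurable f).measurable
  have hf2 := Lp.memLp f
  set E : Set (Rn n) := {x | s < ‖f x‖} with hE
  have hEm : MeasurableSet E := measurableSet_lt measurable_const hfm.norm
  have h1 : MemLp (E.indicator f) 2 volume := hf2.indicator hEm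
  have h2 : MemLp (Eᶜ.indicator f) 2 volume := hf2.indicator hEm.compl
  -- On the tall part |f| ≤ |f|²/s, so it lies in L¹ ∩ L² and the weak bound applies to it.
  have hi : Integrable (E.indicator f) := by
    refine ((integrable_norm_sq hf2).const_mul s⁻¹).mono' h1.1 (ae_of_all _ fun x => ?_)
    by_cases hx : x ∈ E
    · have hx' : s < ‖f x‖ := hx
      rw [indicator_of_mem hx, ← div_eq_inv_mul, le_div_iff₀ hs, sq]
      gcongr
    · rw [indicator_of_notMem hx, norm_zero]
      positivity
  have hsum : T f = T (h1.toLp _) + T (h2.toLp _) := by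
    rw [← map_add, ← MemLp.toLp_add]
    conv_lhs => rw [← Lp.toLp_coeFn f hf2]
    congr 1
    exact MemLp.toLp_congr _ _ (by rw [indicator_self_add_compl])
  have ht2 : 0 < t / 2 := by positivity
  have hE1 : ENNReal.ofReal (∫ x, ‖E.indicator f x‖) =
      ∫⁻ x, if s < ‖f x‖ then ENNReal.ofReal ‖f x‖ else 0 := by
    rw [ofReal_integral_eq_lintegral_ofReal hi.norm (ae_of_all _ fun _ => norm_nonneg _)]
    congr 1 with x
    by_cases hx : x ∈ E
    · have hx' : s < ‖f x‖ := hx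
      rw [indicator_of_mem hx, if_pos hx']
    · have hx' : ¬ s < ‖f x‖ := hx
      simp [indicator_of_notMem hx, if_neg hx']
  have hE2 : ENNReal.ofReal (∫ x, ‖Eᶜ.indicator f x‖ ^ 2) =
      ∫⁻ x, if s < ‖f x‖ then 0 else ENNReal.ofReal (‖f x‖ ^ 2) := by
    rw [ofReal_integral_eq_lintegral_ofReal (integrable_norm_sq h2)
      (ae_of_all _ fun _ => by positivity)]
    congr 1 with x
    by_cases hx : x ∈ E
    · have hx' : s < ‖f x‖ := hx
      have hxc : x ∉ Eᶜ := not_not.2 hx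
      simp [indicator_of_notMem hxc, if_pos hx']
    · have hx' : ¬ s < ‖f x‖ := hx
      have hxc : x ∈ Eᶜ := hx
      rw [indicator_of_mem hxc, if_neg hx']
  calc volume {x | t < ‖T f x‖} ≤
        volume ({x | t / 2 < ‖T (h1.toLp _) x‖} ∪ {x | t / 2 < ‖T (h2.toLp _) x‖}) := by
        refine measure_mono_ae ?_
        rw [hsum]
        filter_upwards [Lp.coeFn_add (T (h1.toLp _)) (T (h2.toLp _))] with x hx hxt
        by_contra h
        replace h : ¬ (t / 2 < ‖T (h1.toLp _) x‖ ∨ t / 2 < ‖T (h2.toLp _) x‖) := h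
        rw [not_or, not_lt, not_lt] at h
        have hxt' : t < ‖(T (h1.toLp _) + T (h2.toLp _) : LpRn n 2) x‖ := hxt
        rw [hx, Pi.add_apply] at hxt'
        have := norm_add_le (T (h1.toLp _) x) (T (h2.toLp _) x)
        linarith
    _ ≤ volume {x | t / 2 < ‖T (h1.toLp _) x‖} + volume {x | t / 2 < ‖T (h2.toLp _) x‖} :=
        measure_union_le _ _
    _ ≤ ENNReal.ofReal (C * (∫ y, ‖E.indicator f y‖) / (t / 2)) +
        ENNReal.ofReal (B ^ 2 * (∫ y, ‖Eᶜ.indicator f y‖ ^ 2) / (t / 2) ^ 2) := by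
        refine add_le_add (hweak _ h1 hi _ ht2) ?_
        refine (measure_lt_norm_le_of_lp_two _ ht2).trans (ENNReal.ofReal_le_ofReal ?_)
        gcongr
        rw [← norm_toLp_sq_eq_integral h2, ← mul_pow]
        gcongr
        exact (T.le_opNorm _).trans (by gcongr)
    _ = _ := by
        rw [← hE1, ← hE2, ← ENNReal.ofReal_mul (by positivity), ← ENNReal.ofReal_mul (by positivity)]
        congr 2
        · field_simp
        · field_simp
          ring

/-- `T` is bounded with norm at most `C` in the `Lᵖ` norm, on `L² ∩ Lᵖ`. -/
def IsStrongType (T : LpRn n 2 →L[ℂ] LpRn n 2) (p C : ℝ) : Prop :=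
  ∀ f : LpRn n 2, ∫⁻ x, ‖f x‖ₑ ^ p ≠ ∞ →
    (∫⁻ x, ‖T f x‖ₑ ^ p) ^ (1 / p) ≤ ENNReal.ofReal C * (∫⁻ x, ‖f x‖ₑ ^ p) ^ (1 / p)

/-- Interpolation between a weak type `(1, 1)` bound `C` and an `L²` bound `B`, splitting the
functions at the height `κ t`. -/
theorem isStrongType_of_weakType {T : LpRn n 2 →L[ℂ] LpRn n 2} {B C : ℝ} (hTB : ‖T‖ ≤ B)
    (hC : 0 ≤ C)
    (hweak : ∀ (f : Rn n → ℂ) (hf : MemLp f 2 volume), Integrable f → ∀ t : ℝ, 0 < t →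
      volume {x | t < ‖T (hf.toLp f) x‖} ≤ ENNReal.ofReal (C * (∫ y, ‖f y‖) / t))
    {p : ℝ} (hp1 : 1 < p) (hp2 : p < 2) {κ : ℝ} (hκ : 0 < κ) :
    IsStrongType T p ((p * (2 * C * κ ^ (1 - p) / (p - 1) +
      4 * B ^ 2 * κ ^ (2 - p) / (2 - p))) ^ (1 / p)) := by
  intro f _
  have hp0 : 0 < p := by linarith
  have hpm : 0 < p - 1 := by linarith
  have hp2' : 0 < 2 - p := by linarith
  set M := 2 * C * κ ^ (1 - p) / (p - 1) + 4 * B ^ 2 * κ ^ (2 - p) / (2 - p) with hM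
  have hM0 : 0 ≤ M := by positivity
  suffices h : ∫⁻ x, ‖T f x‖ₑ ^ p ≤ ENNReal.ofReal (p * M) * ∫⁻ x, ‖f x‖ₑ ^ p by
    rw [← ENNReal.ofReal_rpow_of_nonneg (by positivity) (by positivity),
      ← ENNReal.mul_rpow_of_nonneg _ _ (by positivity)]
    exact ENNReal.rpow_le_rpow h (by positivity)
  have hfm : Measurable (f : Rn n → ℂ) := (Lp.stronglyMeasurable f).measurable
  have hTm : Measurable (T f : Rn n → ℂ) := (Lp.stronglyMeasurable (T f)).measurable
  have henorm : ∀ z : ℂ, ‖z‖ₑ ^ p = ENNReal.ofReal (‖z‖ ^ p) := fun z => by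
    rw [← ofReal_norm, ENNReal.ofReal_rpow_of_nonneg (norm_nonneg _) hp0.le]
  simp only [henorm]
  rw [lintegral_rpow_eq_lintegral_meas_lt_mul volume (ae_of_all _ fun _ => norm_nonneg _)
    hTm.norm.aemeasurable hp0, ENNReal.ofReal_mul hp0.le, mul_assoc]
  gcongr ENNReal.ofReal p * ?_
  -- The layer-cake integrand after splitting at height κt. For fixed x with a = |f(x)|, the weak
  -- bound is used for t < a/κ, where t^(p-2) is integrable at 0 since p > 1. The L² bound is used
  -- beyond, where t^(p-3) is integrable at infinity since p < 2.
  let Φ : ℝ → Rn n → ℝ≥0∞ := fun t x => if κ * t < ‖f x‖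
    then ENNReal.ofReal (2 * C * t ^ (p - 2)) * ENNReal.ofReal ‖f x‖
    else ENNReal.ofReal (4 * B ^ 2 * t ^ (p - 3)) * ENNReal.ofReal (‖f x‖ ^ 2)
  have hΦm : Measurable (Function.uncurry Φ) := by
    have hn : Measurable fun z : ℝ × Rn n => ‖f z.2‖ := hfm.norm.comp measurable_snd
    have h1 : ∀ c r : ℝ, Measurable fun z : ℝ × Rn n => ENNReal.ofReal (c * z.1 ^ r) := fun c r =>
      ((measurable_fst.pow_const r).const_mul c).ennreal_ofReal
    exact Measurable.ite (measurableSet_lt (measurable_fst.const_mul κ) hn)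
      ((h1 _ _).mul hn.ennreal_ofReal) ((h1 _ _).mul (hn.pow_const 2).ennreal_ofReal)
  calc ∫⁻ t in Ioi 0, volume {x | t < ‖T f x‖} * ENNReal.ofReal (t ^ (p - 1))
      ≤ ∫⁻ t in Ioi 0, ∫⁻ x, Φ t x := by
        refine setLIntegral_mono' measurableSet_Ioi fun t (ht : 0 < t) => ?_
        have h1 : Measurable fun x => if κ * t < ‖f x‖ then ENNReal.ofReal ‖f x‖ else 0 :=
          Measurable.ite (measurableSet_lt measurable_const hfm.norm) hfm.norm.ennreal_ofReal
            measurable_const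
        have h2 : Measurable fun x => if κ * t < ‖f x‖ then 0 else ENNReal.ofReal (‖f x‖ ^ 2) :=
          Measurable.ite (measurableSet_lt measurable_const hfm.norm) measurable_const
            (hfm.norm.pow_const 2).ennreal_ofReal
        have h3 : ENNReal.ofReal (2 * C / t) * ENNReal.ofReal (t ^ (p - 1)) =
            ENNReal.ofReal (2 * C * t ^ (p - 2)) := by
          rw [← ENNReal.ofReal_mul (by positivity)]
          congr 1
          rw [show p - 2 = (p - 1) - 1 by ring, Real.rpow_sub_one ht.ne' (p - 1)]
          ring
        have h4 : ENNReal.ofReal (4 * B ^ 2 / t ^ 2) * ENNReal.ofReal (t ^ (p - 1)) =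
            ENNReal.ofReal (4 * B ^ 2 * t ^ (p - 3)) := by
          rw [← ENNReal.ofReal_mul (by positivity)]
          congr 1
          rw [show p - 3 = (p - 1) - (2 : ℕ) by push_cast; ring, Real.rpow_sub_natCast ht.ne']
          ring
        refine (mul_le_mul_left (measure_lt_norm_le_of_split hTB hC hweak f
          (mul_pos hκ ht) ht) _).trans (le_of_eq ?_)
        rw [add_mul, mul_right_comm, h3, mul_right_comm (ENNReal.ofReal (4 * B ^ 2 / t ^ 2)), h4, ← lintegral_const_mul _ h1,
          ← lintegral_const_mul _ h2, ← lintegral_add_left (h1.const_mul _)]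
        congr 1 with x
        simp only [Φ]
        split_ifs <;> simp
    _ = ∫⁻ x, ∫⁻ t in Ioi 0, Φ t x := lintegral_lintegral_swap hΦm.aemeasurable
    _ ≤ ∫⁻ x, ENNReal.ofReal M * ENNReal.ofReal (‖f x‖ ^ p) := by
        refine lintegral_mono fun x => ?_
        set a := ‖f x‖ with ha
        have ha0 : 0 ≤ a := norm_nonneg _
        rcases ha0.eq_or_lt with h0 | h0
        · have : ∫⁻ t in Ioi 0, Φ t x = 0 := by
            refine (setLIntegral_congr_fun measurableSet_Ioi fun t (ht : 0 < t) => ?_).trans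
              lintegral_zero
            have h1 : ¬ κ * t < 0 := not_lt.2 (by positivity)
            simp only [Φ]
            rw [← ha, ← h0, if_neg h1]
            simp
          rw [this]
          exact zero_le
        · have hc : 0 < a / κ := by positivity
          have hsplit : ∫⁻ t in Ioi 0, Φ t x =
              (∫⁻ t in Ioo 0 (a / κ), Φ t x) + ∫⁻ t in Ici (a / κ), Φ t x := by
            rw [← Ioo_union_Ici_eq_Ioi hc, lintegral_union measurableSet_Ici]
            exact disjoint_left.2 fun t ht ht' => not_lt.2 ht' ht.2
          have h1 : ∫⁻ t in Ioo 0 (a / κ), Φ t x =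
              ENNReal.ofReal (2 * C * κ ^ (1 - p) / (p - 1) * a ^ p) := by
            calc _ = ∫⁻ t in Ioo 0 (a / κ), ENNReal.ofReal (2 * C * a) *
                  ENNReal.ofReal (t ^ (p - 2)) := by
                  refine setLIntegral_congr_fun measurableSet_Ioo fun t ht => ?_
                  have h2 : κ * t < a := by
                    rw [mul_comm]
                    exact (lt_div_iff₀ hκ).1 ht.2
                  have h3 := Real.rpow_nonneg ht.1.le (p - 2)
                  simp only [Φ]
                  rw [← ha, if_pos h2, ← ENNReal.ofReal_mul (by positivity),
                    ← ENNReal.ofReal_mul (by positivity)]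
                  congr 1
                  ring
              _ = _ := by
                  rw [lintegral_const_mul _ (by fun_prop), lintegral_Ioo_rpow (by linarith) hc.le,
                    ← ENNReal.ofReal_mul (by positivity)]
                  congr 1
                  rw [show p - 2 + 1 = p - 1 by ring, Real.div_rpow ha0 hκ.le,
                    show 1 - p = -(p - 1) by ring, Real.rpow_neg hκ.le, Real.rpow_sub_one h0.ne']
                  field_simp
          have h2 : ∫⁻ t in Ici (a / κ), Φ t x =
              ENNReal.ofReal (4 * B ^ 2 * κ ^ (2 - p) / (2 - p) * a ^ p) := by
            calc _ = ∫⁻ t in Ici (a / κ), ENNReal.ofReal (4 * B ^ 2 * a ^ 2) *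
                  ENNReal.ofReal (t ^ (p - 3)) := by
                  refine setLIntegral_congr_fun measurableSet_Ici fun t (ht : a / κ ≤ t) => ?_
                  have h2 : ¬ κ * t < a := by
                    rw [not_lt, mul_comm]
                    exact (div_le_iff₀ hκ).1 ht
                  have h3 := Real.rpow_nonneg (hc.le.trans ht) (p - 3)
                  simp only [Φ]
                  rw [← ha, if_neg h2, ← ENNReal.ofReal_mul (by positivity),
                    ← ENNReal.ofReal_mul (by positivity)]
                  congr 1
                  ring
              _ = _ := by
                  rw [← restrict_Ioi_eq_restrict_Ici, lintegral_const_mul _ (by fun_prop),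
                    lintegral_Ioi_rpow (by linarith) hc, ← ENNReal.ofReal_mul (by positivity)]
                  congr 1
                  rw [show p - 3 + 1 = -(2 - p) by ring, Real.rpow_neg hc.le,
                    Real.div_rpow ha0 hκ.le, show 2 - p = ((2 : ℕ) : ℝ) - p by norm_num,
                    Real.rpow_sub h0, Real.rpow_natCast]
                  field_simp
          rw [hsplit, h1, h2, ← ENNReal.ofReal_add (by positivity) (by positivity),
            ← ENNReal.ofReal_mul hM0]
          refine ENNReal.ofReal_le_ofReal (le_of_eq ?_)
          rw [hM]
          ring
    _ = _ := lintegral_const_mul _ (hfm.norm.pow_const p).ennreal_ofReal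

end Interpolation

/-! ### Dual exponents and extension to Lᵖ. -/

section Duality

variable {n : ℕ}

/-- Strong type bounds pass to the dual exponent of the adjoint operator. -/
theorem IsStrongType.of_adjoint {T : LpRn n 2 →L[ℂ] LpRn n 2} {p q C : ℝ}
    (hpq : p.HolderConjugate q) (h : IsStrongType (ContinuousLinearMap.adjoint T) q C) :
    IsStrongType T p C := by
  intro f hf
  have hp0 := hpq.pos
  have hq0 := hpq.symm.pos
  set u := T f
  have hum : Measurable (u : Rn n → ℂ) := (Lp.stronglyMeasurable u).measurable
  set R := ENNReal.ofReal C * (∫⁻ x, ‖f x‖ₑ ^ p) ^ (1 / p) with hR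
  -- It is not yet known that Tf is in Lᵖ. On each truncation the p-th power integral J is finite,
  -- so J^(1/q) can be cancelled; the bound is uniform in k.
  let E : ℕ → Set (Rn n) := fun k => closedBall 0 k ∩ {x | ‖u x‖ ≤ k}
  have hEm : ∀ k, MeasurableSet (E k) := fun k =>
    measurableSet_closedBall.inter (measurableSet_le hum.norm measurable_const)
  have hEfin : ∀ k, volume (E k) ≠ ∞ := fun k =>
    ((measure_mono inter_subset_left).trans_lt measure_closedBall_lt_top).ne
  have hmono : Monotone E := fun k l hkl => by
    have hkl' : (k : ℝ) ≤ l := by exact_mod_cast hkl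
    exact inter_subset_inter (closedBall_subset_closedBall hkl') fun x (hx : ‖u x‖ ≤ k) =>
      hx.trans hkl'
  have hU : ⋃ k, E k = univ := by
    refine eq_univ_of_forall fun x => ?_
    obtain ⟨k, hk⟩ := exists_nat_ge (max ‖x‖ ‖u x‖)
    refine mem_iUnion.2 ⟨k, ?_, (le_max_right _ _).trans hk⟩
    rw [mem_closedBall_zero_iff]
    exact (le_max_left _ _).trans hk
  have key : ∀ k, (∫⁻ x in E k, ‖u x‖ₑ ^ p) ^ (1 / p) ≤ R := by
    intro k
    set J := ∫⁻ x in E k, ‖u x‖ₑ ^ p with hJ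
    have henorm : ∀ z : ℂ, ∀ r : ℝ, 0 ≤ r → ‖z‖ₑ ^ r = ENNReal.ofReal (‖z‖ ^ r) := fun z r hr => by
      rw [← ofReal_norm, ENNReal.ofReal_rpow_of_nonneg (norm_nonneg _) hr]
    have : IsFiniteMeasure ((volume : Measure (Rn n)).restrict (E k)) :=
      isFiniteMeasure_restrict.2 (hEfin k)
    -- The extremal function of Hölder's inequality: |g|^q = |u|^p and ḡu = |u|^p on `E k`. At zeros
    -- of u the last factor makes g vanish, whatever value the power of 0 takes.
    let g : Rn n → ℂ := (E k).indicator fun x => ((‖u x‖ ^ (p - 2) : ℝ) : ℂ) * u x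
    have hgm : Measurable fun x => ((‖u x‖ ^ (p - 2) : ℝ) : ℂ) * u x :=
      (Complex.measurable_ofReal.comp (hum.norm.pow_const _)).mul hum
    have hgnorm : ∀ x, ‖((‖u x‖ ^ (p - 2) : ℝ) : ℂ) * u x‖ = ‖u x‖ ^ (p - 1) := fun x => by
      rw [norm_mul, Complex.norm_real, Real.norm_of_nonneg (by positivity)]
      rcases (norm_nonneg (u x)).eq_or_lt with h0 | h0
      · rw [← h0, mul_zero, Real.zero_rpow hpq.sub_one_pos.ne']
      · rw [show p - 2 = p - 1 - 1 by ring, Real.rpow_sub_one h0.ne' (p - 1)]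
        field_simp
    have hg : MemLp g 2 volume := by
      refine (memLp_indicator_iff_restrict (hEm k)).2
        (MemLp.of_bound hgm.aestronglyMeasurable ((k : ℝ) ^ (p - 1)) ?_)
      filter_upwards [ae_restrict_mem (hEm k)] with x hx
      rw [hgnorm]
      exact Real.rpow_le_rpow (norm_nonneg _) hx.2 hpq.sub_one_pos.le
    have hgq : ∫⁻ x, ‖hg.toLp g x‖ₑ ^ q = J := by
      rw [hJ, ← lintegral_indicator (hEm k)]
      refine lintegral_congr_ae ?_
      filter_upwards [hg.coeFn_toLp] with x hx
      rw [hx]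
      by_cases hxE : x ∈ E k
      · simp only [g, indicator_of_mem hxE]
        rw [henorm _ _ hq0.le, henorm _ _ hp0.le, hgnorm, ← Real.rpow_mul (norm_nonneg _),
          hpq.sub_one_mul_conj]
      · simp only [g, indicator_of_notMem hxE]
        rw [enorm_zero, ENNReal.zero_rpow_of_pos hq0]
    have hJfin : J ≠ ∞ := by
      have h1 : J ≤ ∫⁻ x in E k, ENNReal.ofReal ((k : ℝ) ^ p) := by
        refine setLIntegral_mono' (hEm k) fun x hx => ?_
        rw [henorm _ _ hp0.le]
        exact ENNReal.ofReal_le_ofReal (Real.rpow_le_rpow (norm_nonneg _) hx.2 hp0.le)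
      refine (h1.trans_lt ?_).ne
      rw [setLIntegral_const]
      exact ENNReal.mul_lt_top ENNReal.ofReal_lt_top (hEfin k).lt_top
    have hinner : ‖inner ℂ (hg.toLp g) u‖ₑ = J := by
      have h1 : inner ℂ (hg.toLp g) u = ((∫ x in E k, ‖u x‖ ^ p : ℝ) : ℂ) := by
        rw [L2.inner_def, ← integral_complex_ofReal, ← integral_indicator (hEm k)]
        refine integral_congr_ae ?_
        filter_upwards [hg.coeFn_toLp] with x hx
        rw [hx, RCLike.inner_apply]
        by_cases hxE : x ∈ E k
        · simp only [g, indicator_of_mem hxE]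
          rw [map_mul, Complex.conj_ofReal, mul_left_comm, Complex.mul_conj,
            Complex.normSq_eq_norm_sq, ← Complex.ofReal_mul]
          congr 1
          rcases (norm_nonneg (u x)).eq_or_lt with h0 | h0
          · rw [← h0, Real.zero_rpow hp0.ne']
            simp
          · rw [show p - 2 = p - (2 : ℕ) by norm_num, Real.rpow_sub_natCast h0.ne']
            field_simp
        · simp [g, hxE]
      have hi : IntegrableOn (fun x => ‖u x‖ ^ p) (E k) := by
        refine Integrable.of_bound (hum.norm.pow_const p).aestronglyMeasurable ((k : ℝ) ^ p) ?_
        filter_upwards [ae_restrict_mem (hEm k)] with x hx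
        rw [Real.norm_of_nonneg (by positivity)]
        exact Real.rpow_le_rpow (norm_nonneg _) hx.2 hp0.le
      rw [h1, ← ofReal_norm, Complex.norm_real,
        Real.norm_of_nonneg (integral_nonneg fun _ => by positivity),
        ofReal_integral_eq_lintegral_ofReal hi (ae_of_all _ fun _ => by positivity)]
      simp only [hJ, henorm _ _ hp0.le]
    set w := ContinuousLinearMap.adjoint T (hg.toLp g)
    have hstrong : (∫⁻ x, ‖w x‖ₑ ^ q) ^ (1 / q) ≤ ENNReal.ofReal C * J ^ (1 / q) := by
      have h1 := h (hg.toLp g) (by rwa [hgq])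
      rwa [hgq] at h1
    have hle : J ≤ R * J ^ (1 / q) := by
      calc J = ‖inner ℂ w f‖ₑ := by
            rw [← hinner, ContinuousLinearMap.adjoint_inner_left]
        _ ≤ ∫⁻ x, ‖f x‖ₑ * ‖w x‖ₑ := by
            rw [L2.inner_def]
            refine (enorm_integral_le_lintegral_enorm _).trans (le_of_eq ?_)
            congr 1 with x
            rw [RCLike.inner_apply, enorm_mul]
            congr 1
            rw [← ofReal_norm, RCLike.norm_conj, ofReal_norm]
        _ ≤ (∫⁻ x, ‖f x‖ₑ ^ p) ^ (1 / p) * (∫⁻ x, ‖w x‖ₑ ^ q) ^ (1 / q) :=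
            ENNReal.lintegral_mul_le_Lp_mul_Lq volume hpq
              (Lp.stronglyMeasurable f).measurable.enorm.aemeasurable
              (Lp.stronglyMeasurable w).measurable.enorm.aemeasurable
        _ ≤ (∫⁻ x, ‖f x‖ₑ ^ p) ^ (1 / p) * (ENNReal.ofReal C * J ^ (1 / q)) := by gcongr
        _ = _ := by rw [hR]; ring
    rcases eq_or_ne J 0 with h0 | h0
    · rw [h0, ENNReal.zero_rpow_of_pos (by positivity)]
      exact zero_le
    · have hJq0 : J ^ (1 / q) ≠ 0 := by
        rw [Ne, ENNReal.rpow_eq_zero_iff_of_pos (by positivity)]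
        exact h0
      have hJqt : J ^ (1 / q) ≠ ∞ := ENNReal.rpow_ne_top_of_nonneg (by positivity) hJfin
      refine (ENNReal.mul_le_mul_iff_left hJq0 hJqt).1 ?_
      rw [← ENNReal.rpow_add _ _ h0 hJfin]
      have h1 : 1 / p + 1 / q = 1 := by
        rw [one_div, one_div]
        exact hpq.inv_add_inv_eq_one
      rwa [h1, ENNReal.rpow_one]
  have hlim : ∫⁻ x, ‖u x‖ₑ ^ p ≤ R ^ p := by
    rw [← setLIntegral_univ, ← withDensity_apply _ MeasurableSet.univ, ← hU, hmono.measure_iUnion]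
    refine iSup_le fun k => ?_
    rw [withDensity_apply _ (hEm k)]
    have h1 := ENNReal.rpow_le_rpow (key k) hp0.le
    rwa [← ENNReal.rpow_mul, one_div_mul_cancel hp0.ne', ENNReal.rpow_one] at h1
  have h1 := ENNReal.rpow_le_rpow hlim (by positivity : 0 ≤ 1 / p)
  rwa [← ENNReal.rpow_mul, mul_one_div_cancel hp0.ne', ENNReal.rpow_one] at h1

lemma isStrongType_two (T : LpRn n 2 →L[ℂ] LpRn n 2) : IsStrongType T 2 ‖T‖ := by
  intro f _
  have h : ∀ w : LpRn n 2, (∫⁻ x, ‖w x‖ₑ ^ (2 : ℝ)) ^ (1 / (2 : ℝ)) = ENNReal.ofReal ‖w‖ := by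
    intro w
    rw [Lp.norm_def, ENNReal.ofReal_toReal (Lp.eLpNorm_ne_top w),
      eLpNorm_eq_lintegral_rpow_enorm_toReal (by norm_num) (by norm_num)]
    norm_num
  rw [h, h, ← ENNReal.ofReal_mul (norm_nonneg _)]
  exact ENNReal.ofReal_le_ofReal (T.le_opNorm f)

/-- A strong type bound on `L² ∩ Lᵖ` gives a bounded extension to `Lᵖ`. -/
theorem IsStrongType.isBoundedOnLp {T : LpRn n 2 →L[ℂ] LpRn n 2} {p C : ℝ} (hp : 1 < p)
    (hC : 0 ≤ C) (h : IsStrongType T p C) : IsBoundedOnLp T (ENNReal.ofReal p) C := by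
  have hp0 : 0 < p := by linarith
  have hP0 : ENNReal.ofReal p ≠ 0 := (ENNReal.ofReal_pos.2 hp0).ne'
  have hPt : ENNReal.ofReal p ≠ ∞ := ENNReal.ofReal_ne_top
  have : Fact (1 ≤ ENNReal.ofReal p) := ⟨by simpa using hp.le⟩
  have heq : ∀ w : Rn n → ℂ, eLpNorm w (ENNReal.ofReal p) volume =
      (∫⁻ x, ‖w x‖ₑ ^ p) ^ (1 / p) := fun w => by
    rw [eLpNorm_eq_lintegral_rpow_enorm_toReal hP0 hPt, ENNReal.toReal_ofReal hp0.le]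
  have hbound : ∀ f : LpRn n 2, MemLp f (ENNReal.ofReal p) volume →
      eLpNorm (T f) (ENNReal.ofReal p) volume ≤
        ENNReal.ofReal C * eLpNorm f (ENNReal.ofReal p) volume := by
    intro f hf
    rw [heq, heq]
    refine h f fun htop => ?_
    have h1 := hf.2
    rw [heq, htop, ENNReal.top_rpow_of_pos (by positivity)] at h1
    exact lt_irrefl _ h1
  have hmem : ∀ f : LpRn n 2, MemLp f (ENNReal.ofReal p) volume →
      MemLp (T f) (ENNReal.ofReal p) volume := fun f hf =>
    ⟨Lp.aestronglyMeasurable _, (hbound f hf).trans_lt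
      (ENNReal.mul_lt_top ENNReal.ofReal_lt_top hf.2)⟩
  let D : Submodule ℂ (LpRn n 2) :=
    { carrier := {f | MemLp f (ENNReal.ofReal p) volume}
      add_mem' := fun {a b} ha hb => (memLp_congr_ae (Lp.coeFn_add a b)).2 (ha.add hb)
      zero_mem' := (memLp_congr_ae (Lp.coeFn_zero ℂ 2 volume)).2 MemLp.zero
      smul_mem' := fun c a ha => (memLp_congr_ae (Lp.coeFn_smul c a)).2 (ha.const_smul c) }
  let e : D →ₗ[ℂ] LpRn n (ENNReal.ofReal p) :=
    { toFun := fun f => MemLp.toLp f.1 f.2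
      map_add' := fun a b => by
        rw [← MemLp.toLp_add]
        exact MemLp.toLp_congr _ _ (Lp.coeFn_add a.1 b.1)
      map_smul' := fun c a => by
        rw [RingHom.id_apply, ← MemLp.toLp_const_smul]
        exact MemLp.toLp_congr _ _ (Lp.coeFn_smul c a.1) }
  let S : D →ₗ[ℂ] LpRn n (ENNReal.ofReal p) :=
    { toFun := fun f => MemLp.toLp (T f.1) (hmem f.1 f.2)
      map_add' := fun a b => by
        rw [← MemLp.toLp_add]
        refine MemLp.toLp_congr _ _ ?_
        rw [Submodule.coe_add, map_add]
        exact Lp.coeFn_add (T a.1) (T b.1)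
      map_smul' := fun c a => by
        rw [RingHom.id_apply, ← MemLp.toLp_const_smul]
        refine MemLp.toLp_congr _ _ ?_
        rw [Submodule.coe_smul, map_smul]
        exact Lp.coeFn_smul c (T a.1) }
  have hnorm : ∀ f : D, ‖S f‖ ≤ C * ‖e f‖ := by
    intro f
    have h1 : ‖S f‖ = (eLpNorm (T f.1) (ENNReal.ofReal p) volume).toReal :=
      Lp.norm_toLp _ (hmem f.1 f.2)
    have h2 : ‖e f‖ = (eLpNorm f.1 (ENNReal.ofReal p) volume).toReal := Lp.norm_toLp _ f.2
    rw [h1, h2]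
    have h3 := ENNReal.toReal_mono (ENNReal.mul_lt_top ENNReal.ofReal_lt_top f.2.2).ne
      (hbound f.1 f.2)
    rwa [ENNReal.toReal_mul, ENNReal.toReal_ofReal hC] at h3
  -- Simple functions in Lᵖ live on sets of finite measure, so they are also in L².
  have hdense : DenseRange e := by
    refine (Lp.simpleFunc.denseRange hPt).mono ?_
    rintro _ ⟨g, rfl⟩
    have hg := Lp.simpleFunc.memLp g
    have hg2 : MemLp (Lp.simpleFunc.toSimpleFunc g) 2 volume :=
      (SimpleFunc.memLp_iff_finMeasSupp (by norm_num) (by norm_num)).2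
        ((SimpleFunc.memLp_iff_finMeasSupp hP0 hPt).1 hg)
    have hgD : hg2.toLp _ ∈ D := (memLp_congr_ae hg2.coeFn_toLp).2 hg
    refine ⟨⟨hg2.toLp _, hgD⟩, ?_⟩
    ext1
    refine (MemLp.coeFn_toLp hgD).trans (hg2.coeFn_toLp.trans ?_)
    exact Lp.simpleFunc.toSimpleFunc_eq_toFun g
  refine ⟨(S.extendOfNorm e).toLinearMap, fun f g hfg => ?_,
    LinearMap.norm_extendOfNorm_apply_le hdense C hnorm⟩
  have hfD : f ∈ D := (memLp_congr_ae hfg).2 (Lp.memLp g)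
  have h1 : e ⟨f, hfD⟩ = g := by
    ext1
    exact (MemLp.coeFn_toLp hfD).trans hfg
  have h2 := LinearMap.extendOfNorm_eq hdense ⟨C, hnorm⟩ ⟨f, hfD⟩
  rw [h1] at h2
  have h3 : (S.extendOfNorm e).toLinearMap g = S ⟨f, hfD⟩ := h2
  rw [h3]
  exact (MemLp.coeFn_toLp (hmem f hfD)).symm

end Duality

/-! ### Extension of weak type operators to L¹. -/

section WeakExtension

variable {n : ℕ}

/-- A weak type `(1, 1)` bound on `L¹ ∩ L²` gives almost everywhere convergence to zero along
sequences that tend to zero geometrically in `L¹`. -/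
lemma ae_tendsto_zero_of_weakType {T : LpRn n 2 →L[ℂ] LpRn n 2} {C : ℝ} (hC : 0 ≤ C)
    (hweak : ∀ f : LpRn n 2, Integrable f → ∀ t : ℝ, 0 < t →
      volume {x | t < ‖T f x‖} ≤ ENNReal.ofReal (C * (∫ y, ‖f y‖) / t))
    {h : ℕ → LpRn n 2} (hi : ∀ k, Integrable (h k)) {M : ℝ}
    (hM : ∀ k, ∫ y, ‖h k y‖ ≤ M * (1 / 4) ^ k) :
    ∀ᵐ x, ∀ᶠ k in atTop, ‖T (h k) x‖ ≤ (1 / 2) ^ k := by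
  -- Borel–Cantelli: at threshold 2^(-k), norms of order 4^(-k) leave sets of measure O(2^(-k)).
  have hsum : ∑' k : ℕ, volume {x | (1 / 2 : ℝ) ^ k < ‖T (h k) x‖} ≠ ∞ := by
    have hle : ∀ k : ℕ, volume {x | (1 / 2 : ℝ) ^ k < ‖T (h k) x‖} ≤
        ENNReal.ofReal (C * M * (1 / 2) ^ k) := fun k => by
      refine (hweak (h k) (hi k) _ (by positivity)).trans (ENNReal.ofReal_le_ofReal ?_)
      rw [div_le_iff₀ (by positivity), mul_assoc, ← mul_pow, mul_assoc]
      have := hM k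
      norm_num at this ⊢
      gcongr
    have hM0 : 0 ≤ M := by
      have := (integral_nonneg fun y => norm_nonneg (h 0 y)).trans (hM 0)
      simpa using this
    refine ne_top_of_le_ne_top ?_ (ENNReal.tsum_le_tsum hle)
    rw [← ENNReal.ofReal_tsum_of_nonneg (fun k => by positivity)
      (summable_geometric_two.mul_left (C * M))]
    exact ENNReal.ofReal_ne_top
  filter_upwards [ae_finite_setOfPred_mem hsum] with x hx
  have h1 : ∀ᶠ k in atTop, k ∉ {k : ℕ | x ∈ {x | (1 / 2 : ℝ) ^ k < ‖T (h k) x‖}} := by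
    rw [← Nat.cofinite_eq_atTop]
    exact hx.eventually_cofinite_notMem
  filter_upwards [h1] with k hk
  exact not_lt.1 hk

lemma tendsto_zero_of_eventually_norm_le {a : ℕ → ℂ}
    (h : ∀ᶠ k in atTop, ‖a k‖ ≤ (1 / 2) ^ k) : Tendsto a atTop (nhds 0) :=
  squeeze_zero_norm' h (tendsto_pow_atTop_nhds_zero_of_lt_one (by norm_num) (by norm_num))

lemma exists_tendsto_of_eventually_norm_sub_le {a : ℕ → ℂ}
    (h : ∀ᶠ k in atTop, ‖a (k + 1) - a k‖ ≤ (1 / 2) ^ k) : ∃ l, Tendsto a atTop (nhds l) := by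
  obtain ⟨m, hm⟩ := eventually_atTop.1 h
  have hc : CauchySeq fun k => a (k + m) := by
    refine cauchySeq_of_le_geometric (1 / 2) 1 (by norm_num) fun k => ?_
    rw [dist_comm, dist_eq_norm, show k + 1 + m = k + m + 1 by ring, one_mul]
    refine (hm (k + m) (by lia)).trans ?_
    exact pow_le_pow_of_le_one (by norm_num) (by norm_num) (by lia)
  obtain ⟨l, hl⟩ := cauchySeq_tendsto_of_complete hc
  exact ⟨l, (tendsto_add_atTop_iff_nat m).1 hl⟩

lemma exists_lp_two_approx (g : LpRn n 1) {ε : ℝ} (hε : 0 < ε) :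
    ∃ f : LpRn n 2, Integrable f ∧ ∫ y, ‖f y - g y‖ ≤ ε := by
  obtain ⟨s, hs⟩ := (Lp.simpleFunc.denseRange (E := ℂ) (μ := (volume : Measure (Rn n)))
    ENNReal.one_ne_top).exists_dist_lt g hε
  have h1 := Lp.simpleFunc.memLp s
  have h2 : MemLp (Lp.simpleFunc.toSimpleFunc s) 2 volume :=
    (SimpleFunc.memLp_iff_finMeasSupp (by norm_num) (by norm_num)).2
      ((SimpleFunc.memLp_iff_finMeasSupp one_ne_zero ENNReal.one_ne_top).1 h1)
  refine ⟨h2.toLp _, (integrable_congr h2.coeFn_toLp).2 (memLp_one_iff_integrable.1 h1), ?_⟩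
  rw [dist_comm, dist_eq_norm, L1.norm_eq_integral_norm] at hs
  refine le_trans (le_of_eq (integral_congr_ae ?_)) hs.le
  filter_upwards [h2.coeFn_toLp, Lp.simpleFunc.toSimpleFunc_eq_toFun s,
    Lp.coeFn_sub (s : LpRn n 1) g] with x e1 e2 e3
  rw [e1, e2, e3, Pi.sub_apply]

/-- A weak type bound on `L¹ ∩ L²` gives an extension of weak type `(1, 1)` to `L¹`. -/
theorem isWeakTypeOneOne_of_weakType {T : LpRn n 2 →L[ℂ] LpRn n 2} {C : ℝ} (hC : 0 ≤ C)
    (hweak : ∀ f : LpRn n 2, Integrable f → ∀ t : ℝ, 0 < t →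
      volume {x | t < ‖T f x‖} ≤ ENNReal.ofReal (C * (∫ y, ‖f y‖) / t)) :
    IsWeakTypeOneOne T C := by
  -- The extension is the almost everywhere limit of T along approximations at rate 4^(-k).
  -- Existence of the limit, linearity and agreement with T each reduce to a combination of
  -- approximations that tends to zero geometrically in L¹.
  choose app happi happ using fun (g : LpRn n 1) (k : ℕ) =>
    exists_lp_two_approx g (ε := (1 / 4) ^ k) (by positivity)
  have hgi : ∀ g : LpRn n 1, Integrable g := fun g => L1.integrable_coeFn g
  have hdi : ∀ g k, Integrable fun y => ‖app g k y - g y‖ := fun g k =>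
    ((happi g k).sub (hgi g)).norm
  have hlim : ∀ g : LpRn n 1, ∃ L : Rn n → ℂ, Measurable L ∧
      ∀ᵐ x, Tendsto (fun k => T (app g k) x) atTop (nhds (L x)) := by
    intro g
    refine measurable_limit_of_tendsto_metrizable_ae
      (fun k => (Lp.stronglyMeasurable (T (app g k))).measurable.aemeasurable) ?_
    have hi : ∀ k, Integrable (app g (k + 1) - app g k : LpRn n 2) := fun k =>
      (integrable_congr (Lp.coeFn_sub _ _)).2 ((happi g (k + 1)).sub (happi g k))
    have hM : ∀ k, ∫ y, ‖(app g (k + 1) - app g k : LpRn n 2) y‖ ≤ 2 * (1 / 4) ^ k := by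
      intro k
      calc _ ≤ ∫ y, (‖app g (k + 1) y - g y‖ + ‖app g k y - g y‖) := by
            refine integral_mono_ae (hi k).norm ((hdi g _).add (hdi g k)) ?_
            filter_upwards [Lp.coeFn_sub (app g (k + 1)) (app g k)] with y hy
            rw [hy, Pi.sub_apply, ← sub_sub_sub_cancel_right _ _ (g y)]
            exact norm_sub_le _ _
        _ ≤ (1 / 4) ^ (k + 1) + (1 / 4) ^ k := by
            rw [integral_add (hdi g _) (hdi g k)]
            exact add_le_add (happ g _) (happ g k)
        _ ≤ _ := by
            have : (1 / 4 : ℝ) ^ (k + 1) ≤ (1 / 4) ^ k :=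
              pow_le_pow_of_le_one (by norm_num) (by norm_num) (by lia)
            linarith
    have hsub : ∀ᵐ x, ∀ k, T (app g (k + 1) - app g k) x = T (app g (k + 1)) x - T (app g k) x := by
      refine ae_all_iff.2 fun k => ?_
      rw [map_sub]
      exact Lp.coeFn_sub _ _
    filter_upwards [ae_tendsto_zero_of_weakType hC hweak hi hM, hsub] with x hx hx'
    refine exists_tendsto_of_eventually_norm_sub_le ?_
    simpa only [hx'] using hx
  choose L hLm hL using hlim
  have hadd : ∀ g g' : LpRn n 1, L (g + g') =ᵐ[volume] L g + L g' := by
    intro g g'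
    let h : ℕ → LpRn n 2 := fun k => app (g + g') k - (app g k + app g' k)
    have hh : ∀ k, h k =ᵐ[volume] fun y => app (g + g') k y - (app g k y + app g' k y) := by
      intro k
      filter_upwards [Lp.coeFn_sub (app (g + g') k) (app g k + app g' k),
        Lp.coeFn_add (app g k) (app g' k)] with y h1 h2
      rw [h1, Pi.sub_apply, h2, Pi.add_apply]
    have hi : ∀ k, Integrable (h k) := fun k => (integrable_congr (hh k)).2
      ((happi _ k).sub ((happi g k).add (happi g' k)))
    have hM : ∀ k, ∫ y, ‖h k y‖ ≤ 3 * (1 / 4) ^ k := by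
      intro k
      have hs : Integrable fun y => ‖app (g + g') k y - (g + g' : LpRn n 1) y‖ +
          ‖app g k y - g y‖ := (hdi (g + g') k).add (hdi g k)
      calc _ ≤ ∫ y, (‖app (g + g') k y - (g + g' : LpRn n 1) y‖ + ‖app g k y - g y‖ +
              ‖app g' k y - g' y‖) := by
            refine integral_mono_ae (hi k).norm (hs.add (hdi g' k)) ?_
            filter_upwards [hh k, Lp.coeFn_add g g'] with y hy hy'
            rw [hy, hy', Pi.add_apply]
            have : app (g + g') k y - (app g k y + app g' k y) =
                (app (g + g') k y - (g y + g' y)) - (app g k y - g y) - (app g' k y - g' y) := by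
              ring
            rw [this]
            refine (norm_sub_le _ _).trans ?_
            gcongr
            exact norm_sub_le _ _
        _ ≤ (1 / 4) ^ k + (1 / 4) ^ k + (1 / 4) ^ k := by
            rw [integral_add hs (hdi g' k), integral_add (hdi _ k) (hdi g k)]
            exact add_le_add (add_le_add (happ _ k) (happ g k)) (happ g' k)
        _ = _ := by ring
    have hT : ∀ᵐ x, ∀ k, T (h k) x = T (app (g + g') k) x - (T (app g k) x + T (app g' k) x) := by
      refine ae_all_iff.2 fun k => ?_
      simp only [h, map_sub, map_add]
      filter_upwards [Lp.coeFn_sub (T (app (g + g') k)) (T (app g k) + T (app g' k)),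
        Lp.coeFn_add (T (app g k)) (T (app g' k))] with y h1 h2
      rw [h1, Pi.sub_apply, h2, Pi.add_apply]
    filter_upwards [ae_tendsto_zero_of_weakType hC hweak hi hM, hT, hL (g + g'), hL g, hL g']
      with x h1 h2 h3 h4 h5
    have h6 := tendsto_zero_of_eventually_norm_le h1
    simp only [h2] at h6
    exact sub_eq_zero.1 (tendsto_nhds_unique (h3.sub (h4.add h5)) h6)
  have hsmul : ∀ (c : ℂ) (g : LpRn n 1), L (c • g) =ᵐ[volume] c • L g := by
    intro c g
    let h : ℕ → LpRn n 2 := fun k => app (c • g) k - c • app g k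
    have hh : ∀ k, h k =ᵐ[volume] fun y => app (c • g) k y - c • app g k y := by
      intro k
      filter_upwards [Lp.coeFn_sub (app (c • g) k) (c • app g k),
        Lp.coeFn_smul c (app g k)] with y h1 h2
      rw [h1, Pi.sub_apply, h2, Pi.smul_apply]
    have hi : ∀ k, Integrable (h k) := fun k => (integrable_congr (hh k)).2
      ((happi _ k).sub ((happi g k).smul c))
    have hM : ∀ k, ∫ y, ‖h k y‖ ≤ (1 + ‖c‖) * (1 / 4) ^ k := by
      intro k
      calc _ ≤ ∫ y, (‖app (c • g) k y - (c • g : LpRn n 1) y‖ + ‖c‖ * ‖app g k y - g y‖) := by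
            refine integral_mono_ae (hi k).norm ((hdi _ k).add ((hdi g k).const_mul _)) ?_
            filter_upwards [hh k, Lp.coeFn_smul c g] with y hy hy'
            rw [hy, hy', Pi.smul_apply, ← norm_smul, smul_sub]
            have : app (c • g) k y - c • app g k y =
                (app (c • g) k y - c • g y) - (c • app g k y - c • g y) := by ring
            rw [this]
            exact norm_sub_le _ _
        _ ≤ (1 / 4) ^ k + ‖c‖ * (1 / 4) ^ k := by
            rw [integral_add (hdi _ k) ((hdi g k).const_mul _), integral_const_mul]
            exact add_le_add (happ _ k) (mul_le_mul_of_nonneg_left (happ g k) (norm_nonneg c))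
        _ = _ := by ring
    have hT : ∀ᵐ x, ∀ k, T (h k) x = T (app (c • g) k) x - c • T (app g k) x := by
      refine ae_all_iff.2 fun k => ?_
      simp only [h, map_sub, map_smul]
      filter_upwards [Lp.coeFn_sub (T (app (c • g) k)) (c • T (app g k)),
        Lp.coeFn_smul c (T (app g k))] with y h1 h2
      rw [h1, Pi.sub_apply, h2, Pi.smul_apply]
    filter_upwards [ae_tendsto_zero_of_weakType hC hweak hi hM, hT, hL (c • g), hL g]
      with x h1 h2 h3 h4
    have h6 := tendsto_zero_of_eventually_norm_le h1
    simp only [h2] at h6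
    exact sub_eq_zero.1 (tendsto_nhds_unique (h3.sub (h4.const_smul c)) h6)
  let U : LpRn n 1 →ₗ[ℂ] (Rn n →ₘ[volume] ℂ) :=
    { toFun := fun g => AEEqFun.mk (L g) (hLm g).aestronglyMeasurable
      map_add' := fun g g' => by
        rw [AEEqFun.mk_add_mk]
        exact AEEqFun.mk_eq_mk.2 (hadd g g')
      map_smul' := fun c g => by
        rw [RingHom.id_apply, AEEqFun.smul_mk]
        exact AEEqFun.mk_eq_mk.2 (hsmul c g) }
  have hU : ∀ g, U g =ᵐ[volume] L g := fun g => AEEqFun.coeFn_mk _ _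
  refine ⟨U, fun f g hfg => ?_, fun g t ht => ?_⟩
  · refine EventuallyEq.trans ?_ (hU g).symm
    have hfi : Integrable f := (integrable_congr hfg).2 (hgi g)
    have hi : ∀ k, Integrable (app g k - f : LpRn n 2) := fun k =>
      (integrable_congr (Lp.coeFn_sub _ _)).2 ((happi g k).sub hfi)
    have hM : ∀ k, ∫ y, ‖(app g k - f : LpRn n 2) y‖ ≤ 1 * (1 / 4) ^ k := by
      intro k
      rw [one_mul]
      refine le_trans (le_of_eq (integral_congr_ae ?_)) (happ g k)
      filter_upwards [Lp.coeFn_sub (app g k) f, hfg] with y h1 h2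
      rw [h1, Pi.sub_apply, h2]
    have hsub : ∀ᵐ x, ∀ k, T (app g k - f) x = T (app g k) x - T f x := by
      refine ae_all_iff.2 fun k => ?_
      rw [map_sub]
      exact Lp.coeFn_sub _ _
    filter_upwards [ae_tendsto_zero_of_weakType hC hweak hi hM, hsub, hL g] with x h1 h2 h3
    have h6 := tendsto_zero_of_eventually_norm_le h1
    simp only [h2] at h6
    exact (sub_eq_zero.1 (tendsto_nhds_unique (h3.sub_const (T f x)) h6)).symm
  · let S : ℕ → Set (Rn n) := fun k => {x | t < ‖T (app g k) x‖}
    -- The level set of the limit lies in the lower limit of the level sets. The weak bounds, with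
    -- ‖g‖ + 4^(-k) in place of the norm, pass to the limit with no loss in the constant.
    have hsub : volume {x | t < ‖U g x‖} ≤ volume (⋃ m, ⋂ k ≥ m, S k) := by
      refine measure_mono_ae ?_
      filter_upwards [hU g, hL g] with x h1 h2 h3
      have h3' : t < ‖U g x‖ := h3
      rw [h1] at h3'
      obtain ⟨m, hm⟩ := eventually_atTop.1 (h2.norm.eventually (lt_mem_nhds h3'))
      exact mem_iUnion.2 ⟨m, mem_iInter₂.2 fun k hk => hm k hk⟩
    refine hsub.trans ?_
    rw [Monotone.measure_iUnion]
    · refine iSup_le fun m => ?_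
      have hbound : ∀ k ≥ m, volume (⋂ k ≥ m, S k) ≤
          ENNReal.ofReal (C * (‖g‖ + (1 / 4) ^ k) / t) := by
        intro k hk
        refine (measure_mono (biInter_subset_of_mem hk)).trans
          ((hweak (app g k) (happi g k) t ht).trans (ENNReal.ofReal_le_ofReal ?_))
        gcongr
        have h1 : ∫ y, ‖app g k y‖ ≤ ∫ y, (‖g y‖ + ‖app g k y - g y‖) := by
          refine integral_mono (happi g k).norm ((hgi g).norm.add (hdi g k)) fun y => ?_
          exact norm_le_norm_add_norm_sub' _ _
        rw [integral_add (hgi g).norm (hdi g k), ← L1.norm_eq_integral_norm] at h1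
        exact h1.trans (add_le_add le_rfl (happ g k))
      refine ge_of_tendsto (x := atTop) (f := fun k : ℕ =>
        ENNReal.ofReal (C * (‖g‖ + (1 / 4) ^ k) / t)) ?_ (eventually_atTop.2 ⟨m, hbound⟩)
      refine ENNReal.tendsto_ofReal ?_
      have h1 : Tendsto (fun k : ℕ => (1 / 4 : ℝ) ^ k) atTop (nhds 0) :=
        tendsto_pow_atTop_nhds_zero_of_lt_one (by norm_num) (by norm_num)
      simpa using ((h1.const_add ‖g‖).const_mul C).div_const t
    · intro m m' hm
      exact biInter_subset_biInter_left fun k hk => le_trans hm hk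

end WeakExtension

/-! ### Degenerate cases and assembly over all exponents. -/

section Main

variable {n N : ℕ}

lemma JointGradientBound.mono {ξ : Fin N → Rn n} {K : Fin N → Rn n → Rn n → ℂ} {A A' : ℝ}
    (hK : JointGradientBound ξ K A) (h : A ≤ A') : JointGradientBound ξ K A' := fun x y hxy =>
  ⟨(hK x y hxy).1, (hK x y hxy).2.trans (by gcongr)⟩

lemma IsStrongType.mono {T : LpRn n 2 →L[ℂ] LpRn n 2} {p C C' : ℝ} (h : IsStrongType T p C)
    (hC : C ≤ C') : IsStrongType T p C' := fun f hf => (h f hf).trans (by gcongr)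

lemma IsMultiFrequencyCZ.exists_weakKernel {ξ : Fin N → Rn n} {A : ℝ}
    {T : LpRn n 2 →L[ℂ] LpRn n 2} (h : IsMultiFrequencyCZ ξ A T) :
    ∃ K, JointGradientBound ξ K (max A 0) ∧ HasWeakKernel T (kernelSum K) := by
  obtain ⟨S, K, hT, hS, hK⟩ := h
  exact ⟨K, hK.mono (le_max_left _ _), hasWeakKernel_kernelSum hT hS hK⟩

lemma IsMultiFrequencyCZ.eq_zero {ξ : Fin 0 → Rn n} {A : ℝ}
    {T : LpRn n 2 →L[ℂ] LpRn n 2} (h : IsMultiFrequencyCZ ξ A T) : T = 0 := by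
  obtain ⟨S, K, hT, -, -⟩ := h
  ext1 f
  refine Subtype.ext ?_
  rw [hT f]
  rfl

lemma isStrongType_zero {p C : ℝ} (hp : 0 < p) :
    IsStrongType (0 : LpRn n 2 →L[ℂ] LpRn n 2) p C := by
  intro f _
  have h : ∫⁻ x, ‖(0 : LpRn n 2 →L[ℂ] LpRn n 2) f x‖ₑ ^ p = 0 := by
    rw [zero_apply, ← lintegral_zero (μ := (volume : Measure (Rn n)))]
    refine lintegral_congr_ae ?_
    filter_upwards [Lp.coeFn_zero ℂ 2 (volume : Measure (Rn n))] with x hx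
    rw [hx, Pi.zero_apply, enorm_zero, ENNReal.zero_rpow_of_pos hp]
  rw [h, ENNReal.zero_rpow_of_pos (by positivity)]
  exact zero_le

lemma isWeakTypeOneOne_zero {C : ℝ} (hC : 0 ≤ C) :
    IsWeakTypeOneOne (0 : LpRn n 2 →L[ℂ] LpRn n 2) C := by
  refine isWeakTypeOneOne_of_weakType hC fun f _ t ht => ?_
  refine (measure_mono_ae (t := ∅) ?_).trans (by simp)
  rw [zero_apply]
  filter_upwards [Lp.coeFn_zero ℂ 2 (volume : Measure (Rn n))] with x hx hxt
  have hxt' : t < ‖(0 : LpRn n 2) x‖ := hxt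
  rw [hx, Pi.zero_apply, norm_zero] at hxt'
  exact absurd hxt' (not_lt.2 ht.le)

/-- The strong type bounds below `L²`. -/
theorem exists_strongType_bound (n : ℕ) [Nontrivial (Rn n)] {A B : ℝ} (hA : 0 ≤ A) {p : ℝ}
    (hp1 : 1 < p) (hp2 : p < 2) :
    ∃ C : ℝ, 0 ≤ C ∧ ∀ (N : ℕ) (ξ : Fin N → Rn n) (K : Fin N → Rn n → Rn n → ℂ)
      (T : LpRn n 2 →L[ℂ] LpRn n 2), 0 < N → ‖T‖ ≤ B → JointGradientBound ξ K A →
      HasWeakKernel T (kernelSum K) → IsStrongType T p (C * (N : ℝ) ^ (1 / p - 1 / 2)) := by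
  obtain ⟨C₀, hC₀, hweak⟩ := exists_weakType_bound n (B := B) hA
  have hpm : 0 < p - 1 := by linarith
  have hp2' : 0 < 2 - p := by linarith
  have hp0 : 0 < p := by linarith
  set M := p * (2 * C₀ / (p - 1) + 4 * B ^ 2 / (2 - p)) with hM
  have hM0 : 0 ≤ M := by positivity
  refine ⟨M ^ (1 / p), by positivity, fun N ξ K T hN hTB hK hT => ?_⟩
  have hN0 : (0 : ℝ) < N := by exact_mod_cast hN
  have hκ : 0 < Real.sqrt N := Real.sqrt_pos.2 hN0
  -- With weak constant of order √N, the choice κ = √N makes both terms multiples of κ^(2-p). The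
  -- p-th root of this is N^(1/p - 1/2).
  have h1 := isStrongType_of_weakType hTB (C := C₀ * Real.sqrt N) (by positivity)
    (fun f hf hfi t ht => (hweak N ξ K T hN hTB hK hT f hf hfi t ht).trans
      (le_of_eq (by congr 1; ring))) hp1 hp2 hκ
  refine h1.mono (le_of_eq ?_)
  have h2 : Real.sqrt N * Real.sqrt N ^ (1 - p) = Real.sqrt N ^ (2 - p) := by
    rw [show 2 - p = 1 + (1 - p) by ring, Real.rpow_add hκ, Real.rpow_one]
  have h3 : p * (2 * (C₀ * Real.sqrt N) * Real.sqrt N ^ (1 - p) / (p - 1) +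
      4 * B ^ 2 * Real.sqrt N ^ (2 - p) / (2 - p)) = M * Real.sqrt N ^ (2 - p) := by
    rw [hM, ← h2]
    ring
  rw [h3, Real.mul_rpow hM0 (by positivity), ← Real.rpow_mul hκ.le, Real.sqrt_eq_rpow,
    ← Real.rpow_mul hN0.le]
  congr 2
  field_simp

lemma kernelSum_adjointKernel (K : Fin N → Rn n → Rn n → ℂ) :
    kernelSum (adjointKernel K) = fun z => conj (kernelSum K z.swap) := by
  ext z
  simp [kernelSum, adjointKernel]

end Main

theorem theorem1 (n : ℕ) (hn : 0 < n) (A B : ℝ) :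
    (∀ p : ℝ, 1 < p → ∃ C : ℝ, ∀ (N : ℕ) (ξ : Fin N → Rn n) (T : LpRn n 2 →L[ℂ] LpRn n 2),
      ‖T‖ ≤ B → IsMultiFrequencyCZ ξ A T →
        IsBoundedOnLp T (ENNReal.ofReal p) (C * (N : ℝ) ^ |1 / p - 1 / 2|)) ∧
    (∃ C : ℝ, ∀ (N : ℕ) (ξ : Fin N → Rn n) (T : LpRn n 2 →L[ℂ] LpRn n 2),
      ‖T‖ ≤ B → IsMultiFrequencyCZ ξ A T →
        IsWeakTypeOneOne T (C * (N : ℝ) ^ (1 / 2 : ℝ))) := by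
  have : Nonempty (Fin n) := ⟨⟨0, hn⟩⟩
  have : Nontrivial (Rn n) := inferInstance
  have hA : 0 ≤ max A 0 := le_max_right _ _
  constructor
  · intro p hp
    have hp0 : 0 < p := by linarith
    suffices h : ∃ C : ℝ, 0 ≤ C ∧ ∀ (N : ℕ) (ξ : Fin N → Rn n) (K : Fin N → Rn n → Rn n → ℂ)
        (T : LpRn n 2 →L[ℂ] LpRn n 2), 0 < N → ‖T‖ ≤ B → JointGradientBound ξ K (max A 0) →
        HasWeakKernel T (kernelSum K) → IsStrongType T p (C * (N : ℝ) ^ |1 / p - 1 / 2|) by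
      obtain ⟨C, hC, h⟩ := h
      refine ⟨C, fun N ξ T hTB hT => ?_⟩
      have hCN : 0 ≤ C * (N : ℝ) ^ |1 / p - 1 / 2| := by positivity
      -- With no frequencies T is an empty sum, hence 0; the decomposition, which cuts at t/√N,
      -- needs N > 0.
      rcases Nat.eq_zero_or_pos N with rfl | hN
      · rw [hT.eq_zero]
        exact (isStrongType_zero hp0).isBoundedOnLp hp hCN
      · obtain ⟨K, hK, hTK⟩ := hT.exists_weakKernel
        exact (h N ξ K T hN hTB hK hTK).isBoundedOnLp hp hCN
    rcases lt_trichotomy p 2 with hp2 | rfl | hp2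
    · have habs : |1 / p - 1 / 2| = 1 / p - 1 / 2 :=
        abs_of_nonneg (sub_nonneg.2 (one_div_le_one_div_of_le hp0 hp2.le))
      rw [habs]
      exact exists_strongType_bound n hA hp hp2
    · refine ⟨max B 0, le_max_right _ _, fun N ξ K T _ hTB _ _ => ?_⟩
      refine (isStrongType_two T).mono ?_
      simpa using Or.inl hTB
    -- The conjugate exponent q is below 2, and 1/q - 1/2 = 1/2 - 1/p, so the power of N for the
    -- adjoint on L^q is the one required on Lᵖ.
    · have hpq : p.HolderConjugate (p / (p - 1)) := Real.HolderConjugate.conjExponent hp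
      set q := p / (p - 1)
      have hq2 : q < 2 := by
        rw [div_lt_iff₀ (by linarith)]
        linarith
      obtain ⟨C, hC, h⟩ := exists_strongType_bound n (B := B) hA hpq.symm.lt hq2
      refine ⟨C, hC, fun N ξ K T hN hTB hK hTK => ?_⟩
      have habs : |1 / p - 1 / 2| = 1 / q - 1 / 2 := by
        have h1 := hpq.inv_add_inv_eq_one
        rw [abs_of_nonpos (sub_nonpos.2 (one_div_le_one_div_of_le (by norm_num) hp2.le)), one_div,
          one_div q]
        linarith
      rw [habs]
      refine IsStrongType.of_adjoint hpq ?_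
      refine h N ξ (adjointKernel K) _ hN (by rwa [LinearIsometryEquiv.norm_map]) hK.adjoint ?_
      rw [kernelSum_adjointKernel]
      exact hTK.adjoint
  · obtain ⟨C, hC, h⟩ := exists_weakType_bound n (B := B) hA
    refine ⟨C, fun N ξ T hTB hT => ?_⟩
    rcases Nat.eq_zero_or_pos N with rfl | hN
    · rw [hT.eq_zero]
      exact isWeakTypeOneOne_zero (by positivity)
    · obtain ⟨K, hK, hTK⟩ := hT.exists_weakKernel
      refine isWeakTypeOneOne_of_weakType (by positivity) fun f hf t ht => ?_
      have h1 := h N ξ K T hN hTB hK hTK f (Lp.memLp f) hf t ht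
      rw [Lp.toLp_coeFn] at h1
      refine h1.trans (le_of_eq ?_)
      rw [Real.sqrt_eq_rpow]
      congr 1
      ring
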